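/- **Theorem 1.** Let $\alpha\in(0,1)$, $T>0$, and let $\Omega\subset\mathbb R^d$ be open (for example a bounded Lipschitz domain, $d\in\{1,2,3\}$). Write $\langle\cdot,\cdot\rangle$ and $\|\cdot\|$ for the inner product and the norm of $L_2(\Omega)$, and let $\mathcal L v=-\operatorname{div}(A\nabla v+v\,p)+q\cdot\nabla v+c\,v$ be a linear second-order uniformly elliptic operator on $\Omega$ with bounded measurable coefficients $A,p,q,c$ depending on $x$ only, so that $$\langle\mathcal L v,w\rangle=\int_\Omega\bigl(A\nabla v\cdot\nabla w+v\,p\cdot\nabla w+(q\cdot\nabla v)\,w+c\,v\,w\bigr)\,dx\qquad\text{for } v,w\in H_0^1(\Omega).$$ Suppose that for some $\lambda\in\mathbb R$ one has $\langle\mathcal L v,v\rangle\ge\lambda\|v\|^2$ for all $v\in H_0^1(\Omega)$. For $t>0$ let $D_t^\alpha v=J_t^{1-\alpha}(\partial_t v)$ be the Caputo derivative, where $J_t^{1-\alpha}v(t)=\frac1{\Gamma(1-\alpha)}\int_0^t(t-s)^{-\alpha}v(s)\,ds$. For functions $v$ for which $\partial_t v$ need not be integrable at $t=0$, or which may be discontinuous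 at $t=0$, it is understood in the integrated-by-parts form $$\Gamma(1-\alpha)\,D_t^\alpha v(t)=t^{-\alpha}\{v(t)-v(0)\}+\int_0^t\alpha(t-s)^{-\alpha-1}\{v(t)-v(s)\}\,ds .$$ Let $f(\cdot,t)$ be locally integrable in $\Omega$ for each $t\in(0,T]$, let $u_0\in L_2(\Omega)$, and let $u$ be a solution of $$D_t^\alpha u+\mathcal L u=f\ \text{ in }\Omega\times(0,T],\qquad u(\cdot,0)=u_0\ \text{ in }\Omega,\qquad u=0\ \text{ on }\partial\Omega\ \text{ for } t>0,$$ where for each $t\in(0,T]$ the equation holds in the sense of distributions in $\Omega$. Suppose that $u$ and its approximation $u_h$ are in $L_\infty(0,t;L_2(\Omega))\cap W^{1,\infty}(\epsilon,t;L_2(\Omega))$ for any $0<\epsilon<t\le T$, and also in $H_0^1(\Omega)$ for any $t\in(0,T]$, that $u_h(\cdot,0)=u_0$, and that for each $t\in(0,T]$ the residual $R_h(\cdot,t):=(D_t^\alpha+\mathcal L)u_h(\cdot,t)-f(\cdot,t)$ is in $L_2(\Omega)$. Then $$\|(u_h-u)(\cdot,t)\|\le(D_t^\alpha+\lambda)^{-1}\|R_h(\cdot,t)\|\qquad\text{for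 all } t\in(0,T],$$ where $$(D_t^\alpha+\lambda)^{-1}v(t):=\int_0^t(t-s)^{\alpha-1}E_{\alpha,\alpha}\bigl(-\lambda(t-s)^\alpha\bigr)\,v(s)\,ds,\qquad E_{\alpha,\beta}(z)=\sum_{k=0}^\infty\frac{z^k}{\Gamma(\alpha k+\beta)},$$ and the right-hand side is $+\infty$ if this integral, whose integrand is nonnegative, diverges. -/

import Mathlib

open MeasureTheory Set
open scoped ENNReal ContDiff

noncomputable section

/-! ### The time-fractional operators -/

/-- Riemann–Liouville fractional integral
`J^β v (t) = Γ(β)⁻¹ ∫₀ᵗ (t - s)^(β - 1) v(s) ds`. -/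
def fracInt {X : Type*} [NormedAddCommGroup X] [NormedSpace ℝ X]
    (β : ℝ) (v : ℝ → X) (t : ℝ) : X :=
  (Real.Gamma β)⁻¹ • ∫ s in (0 : ℝ)..t, (t - s) ^ (β - 1) • v s

/-- Caputo derivative of order `α ∈ (0,1)` at time `t > 0`, in the integrated-by-parts form
`Γ(1-α) D^α v (t) = t^(-α) (v t - v 0) + ∫₀ᵗ α (t-s)^(-α-1) (v t - v s) ds`.
It equals `J^(1-α) (∂ₜ v) (t)` as soon as `∂ₜ v` is integrable up to time `0` and `v` is
right-continuous at `0` (`caputo_eq_fracInt`). It is also meaningful for functions that are only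
bounded near `t = 0`, possibly with a jump at `0` (the jump then counts as a Dirac mass in
`∂ₜ v`). -/
def caputo {X : Type*} [NormedAddCommGroup X] [NormedSpace ℝ X]
    (α : ℝ) (v : ℝ → X) (t : ℝ) : X :=
  (Real.Gamma (1 - α))⁻¹ •
    (t ^ (-α) • (v t - v 0) + ∫ s in (0 : ℝ)..t, (α * (t - s) ^ (-α - 1)) • (v t - v s))

theorem integral_caputo_weight {α t r : ℝ} (hrt : r < t) (hr0 : 0 ≤ r) :
    ∫ s in (0 : ℝ)..r, α * (t - s) ^ (-α - 1) = (t - r) ^ (-α) - t ^ (-α) := by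
  have hd : ∀ s ∈ uIcc 0 r,
      HasDerivAt (fun s : ℝ => (t - s) ^ (-α)) (α * (t - s) ^ (-α - 1)) s := by
    intro s hs
    rw [uIcc_of_le hr0] at hs
    have hpos : t - s ≠ 0 := by linarith [hs.2]
    have h1 : HasDerivAt (fun s : ℝ => t - s) (-1) s := by
      simpa using (hasDerivAt_id s).const_sub t
    have h2 := h1.rpow_const (p := -α) (Or.inl hpos)
    convert h2 using 1
    ring
  rw [intervalIntegral.integral_eq_sub_of_hasDerivAt hd]
  · simp
  · apply ContinuousOn.intervalIntegrable
    intro s hs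
    rw [uIcc_of_le hr0] at hs
    have hpos : t - s ≠ 0 := by linarith [hs.2]
    apply ContinuousAt.continuousWithinAt
    exact continuousAt_const.mul
      ((continuousAt_const.sub continuousAt_id).rpow_const (Or.inl hpos))

/-- Consistency with the definition `D^α v = J^(1-α) (∂ₜ v)`: here `g` is the weak time
derivative of `v`. -/
theorem caputo_eq_fracInt {X : Type*} [NormedAddCommGroup X] [NormedSpace ℝ X] [CompleteSpace X]
    {α t : ℝ} (h0 : 0 < α) (ht : 0 < t) {v g : ℝ → X}
    (hg : IntervalIntegrable g volume 0 t)
    (hgt : IntervalIntegrable (fun s => (t - s) ^ (-α) • g s) volume 0 t)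
    (hv : ∀ s ∈ Icc 0 t, v t - v s = ∫ r in s..t, g r) :
    caputo α v t = fracInt (1 - α) g t := by
  set μ : Measure ℝ := volume.restrict (Ioo 0 t) with hμ
  have hgI : Integrable g μ := by
    rw [intervalIntegrable_iff_integrableOn_Ioo_of_le ht.le] at hg; exact hg
  have hgtI : Integrable (fun s => (t - s) ^ (-α) • g s) μ := by
    rw [intervalIntegrable_iff_integrableOn_Ioo_of_le ht.le] at hgt; exact hgt
  have hmem : ∀ᵐ r ∂μ, r ∈ Ioo 0 t := ae_restrict_mem measurableSet_Ioo
  -- the kernel on the triangle `s < r`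
  let k : ℝ → ℝ → ℝ := fun s r => if s < r then α * (t - s) ^ (-α - 1) else 0
  have hk_eq : ∀ r, (fun s => k s r) = (Iio r).indicator (fun s => α * (t - s) ^ (-α - 1)) := by
    intro r; funext s; simp [k, indicator]
  have hk0 : ∀ s ∈ Ioo 0 t, ∀ r, 0 ≤ k s r := by
    intro s hs r
    have : 0 ≤ t - s := by linarith [hs.2]
    simp only [k]; split_ifs
    · positivity
    · exact le_rfl
  have hres : ∀ r ∈ Ioo 0 t, Iio r ∩ Ioo 0 t = Ioo 0 r := by
    intro r hr; ext s
    simp only [mem_inter_iff, mem_Iio, mem_Ioo]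
    constructor
    · rintro ⟨a, b, c⟩; exact ⟨b, a⟩
    · rintro ⟨a, b⟩; exact ⟨b, a, b.trans hr.2⟩
  have hk_int : ∀ r ∈ Ioo 0 t, Integrable (fun s => k s r) μ := by
    intro r hr
    rw [hk_eq, integrable_indicator_iff measurableSet_Iio, IntegrableOn, hμ,
      Measure.restrict_restrict measurableSet_Iio, hres r hr]
    have : IntegrableOn (fun s : ℝ => α * (t - s) ^ (-α - 1)) (Icc 0 r) := by
      apply ContinuousOn.integrableOn_Icc
      intro s hs
      have hpos : t - s ≠ 0 := by linarith [hs.2, hr.2]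
      apply ContinuousAt.continuousWithinAt
      exact continuousAt_const.mul
        ((continuousAt_const.sub continuousAt_id).rpow_const (Or.inl hpos))
    exact this.mono_set Ioo_subset_Icc_self
  have hk_val : ∀ r ∈ Ioo 0 t, ∫ s, k s r ∂μ = (t - r) ^ (-α) - t ^ (-α) := by
    intro r hr
    rw [hk_eq, integral_indicator measurableSet_Iio, hμ,
      Measure.restrict_restrict measurableSet_Iio, hres r hr,
      ← integral_Ioc_eq_integral_Ioo, ← intervalIntegral.integral_of_le hr.1.le,
      integral_caputo_weight hr.2 hr.1.le]
  have hkm : Measurable (Function.uncurry k) := by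
    apply Measurable.ite (measurableSet_lt measurable_fst measurable_snd)
    · fun_prop
    · exact measurable_const
  have hF : Integrable (Function.uncurry fun s r => k s r • g r) (μ.prod μ) := by
    have hmeas : AEStronglyMeasurable (Function.uncurry fun s r => k s r • g r) (μ.prod μ) :=
      hkm.aestronglyMeasurable.smul hgI.aestronglyMeasurable.comp_snd
    rw [integrable_prod_iff' hmeas]
    constructor
    · filter_upwards [hmem] with r hr
      exact (hk_int r hr).smul_const (g r)
    · have : Integrable (fun r => ((t - r) ^ (-α) - t ^ (-α)) * ‖g r‖) μ := by
        have h1 := hgtI.norm.sub (hgI.norm.const_mul (t ^ (-α)))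
        refine h1.congr ?_
        filter_upwards [hmem] with r hr
        have : 0 ≤ t - r := by linarith [hr.2]
        simp only [Pi.sub_apply, norm_smul, Real.norm_eq_abs]
        rw [abs_of_nonneg (by positivity)]
        ring
      refine this.congr ?_
      filter_upwards [hmem] with r hr
      rw [← hk_val r hr, ← integral_mul_const]
      apply integral_congr_ae
      filter_upwards [hmem] with s hs
      simp only [Function.uncurry, norm_smul, Real.norm_eq_abs]
      rw [abs_of_nonneg (hk0 s hs r)]
  have hswap := integral_integral_swap hF
  have hL : ∫ s in (0 : ℝ)..t, (α * (t - s) ^ (-α - 1)) • (v t - v s)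
      = ∫ s, ∫ r, k s r • g r ∂μ ∂μ := by
    rw [intervalIntegral.integral_of_le ht.le, integral_Ioc_eq_integral_Ioo]
    apply integral_congr_ae
    filter_upwards [hmem] with s hs
    rw [hv s ⟨hs.1.le, hs.2.le⟩, intervalIntegral.integral_of_le hs.2.le,
      integral_Ioc_eq_integral_Ioo, ← integral_smul]
    have e1 : (fun r => k s r • g r)
        = (Ioi s).indicator (fun r => (α * (t - s) ^ (-α - 1)) • g r) := by
      funext r
      by_cases h : s < r <;> simp [k, h]
    rw [e1, integral_indicator measurableSet_Ioi, hμ,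
      Measure.restrict_restrict measurableSet_Ioi]
    congr 2
    ext r
    simp only [mem_inter_iff, mem_Ioi, mem_Ioo]
    constructor
    · rintro ⟨a, b⟩; exact ⟨a, hs.1.trans a, b⟩
    · rintro ⟨a, _, b⟩; exact ⟨a, b⟩
  have hR : ∫ r, ∫ s, k s r • g r ∂μ ∂μ
      = ∫ r, ((t - r) ^ (-α) • g r - t ^ (-α) • g r) ∂μ := by
    apply integral_congr_ae
    filter_upwards [hmem] with r hr
    rw [integral_smul_const, hk_val r hr, sub_smul]
  have hgint : v t - v 0 = ∫ r, g r ∂μ := by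
    rw [hv 0 ⟨le_rfl, ht.le⟩, intervalIntegral.integral_of_le ht.le,
      integral_Ioc_eq_integral_Ioo]
  have hgc : Integrable (fun r => t ^ (-α) • g r) μ := hgI.smul (t ^ (-α))
  unfold caputo fracInt
  rw [hL, hswap, hR, integral_sub hgtI hgc, integral_smul, hgint,
    intervalIntegral.integral_of_le ht.le, integral_Ioc_eq_integral_Ioo]
  have e2 : (1 - α - 1 : ℝ) = -α := by ring
  rw [e2]
  congr 1
  abel

/-- Generalized Mittag-Leffler function `E_{α,β}(z) = ∑ₖ zᵏ / Γ(α k + β)`. -/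
def mittagLeffler (α β z : ℝ) : ℝ :=
  ∑' k : ℕ, (Real.Gamma (α * k + β))⁻¹ * z ^ k

/-- The kernel `r ↦ r^(α-1) E_{α,α}(-λ r^α)`, `r > 0`. -/
def resolventKernel (α lam r : ℝ) : ℝ :=
  r ^ (α - 1) * mittagLeffler α α (-lam * r ^ α)

/-- The operator `(D_t^α + λ)⁻¹`, i.e.
`v ↦ ∫₀ᵗ (t-s)^(α-1) E_{α,α}(-λ (t-s)^α) v(s) ds`. -/
def caputoResolvent (α lam : ℝ) (v : ℝ → ℝ) (t : ℝ) : ℝ :=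
  ∫ s in (0 : ℝ)..t, resolventKernel α lam (t - s) * v s

/-- The same integral with values in `[0,∞]`, for a function `v ≥ 0` (the kernel is positive):
it is `∞` when the integral diverges. -/
def caputoResolventENN (α lam : ℝ) (v : ℝ → ℝ) (t : ℝ) : ℝ≥0∞ :=
  ∫⁻ s in Ioo 0 t, ENNReal.ofReal (resolventKernel α lam (t - s) * v s)

/-! ### Regularity in time -/

/-- `v ∈ L_∞(a, b; X)`. -/
def MemLinfty {X : Type*} [NormedAddCommGroup X] (a b : ℝ) (v : ℝ → X) : Prop :=
  MemLp v ∞ (volume.restrict (Ioo a b))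

/-- `v ∈ W^{1,∞}(a, b; X)` (for the continuous representative, defined on `[a, b]`): `v` is bounded
and is a primitive of some `g ∈ L_∞(a, b; X)`, its weak time derivative. -/
def MemW1infty {X : Type*} [NormedAddCommGroup X] [NormedSpace ℝ X] (a b : ℝ) (v : ℝ → X) : Prop :=
  MemLinfty a b v ∧ ∃ g : ℝ → X, MemLinfty a b g ∧
    ∀ s ∈ Icc a b, ∀ r ∈ Icc a b, v r - v s = ∫ τ in s..r, g τ

/-- `v ∈ L_∞(0,t;X) ∩ W^{1,∞}(ε,t;X)` for any `0 < ε < t ≤ T`. -/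
def TimeRegular {X : Type*} [NormedAddCommGroup X] [NormedSpace ℝ X] (T : ℝ) (v : ℝ → X) : Prop :=
  ∀ ε t : ℝ, 0 < ε → ε < t → t ≤ T → MemLinfty 0 t v ∧ MemW1infty ε t v

/-! ### The spatial setting -/

/-- `ℝᵈ`. -/
abbrev Rd (d : ℕ) : Type := EuclideanSpace ℝ (Fin d)

/-- `L_2(Ω)`. -/
abbrev L2 {d : ℕ} (Ω : Set (Rd d)) : Type := Lp ℝ 2 (volume.restrict Ω)

/-- `L_2(Ω)ᵈ`. -/
abbrev L2Vec {d : ℕ} (Ω : Set (Rd d)) : Type := Lp (Rd d) 2 (volume.restrict Ω)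

/-- `φ ∈ C_c^∞(Ω)`. -/
def IsTest {d : ℕ} (Ω : Set (Rd d)) (φ : Rd d → ℝ) : Prop :=
  ContDiff ℝ ∞ φ ∧ HasCompactSupport φ ∧ tsupport φ ⊆ Ω

/-- `H_0^1(Ω)`, realised as the set of pairs `(v, ∇v)` with `v ∈ H_0^1(Ω)`: the closure
of `{(φ, ∇φ) : φ ∈ C_c^∞(Ω)}` in `L_2(Ω) × L_2(Ω)ᵈ`, i.e. the closure of `C_c^∞(Ω)` in the
norm of `H^1(Ω)`. -/
def H01 {d : ℕ} (Ω : Set (Rd d)) : Set (L2 Ω × L2Vec Ω) :=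
  closure {p | ∃ φ : Rd d → ℝ, IsTest Ω φ ∧
    (p.1 : Rd d → ℝ) =ᵐ[volume.restrict Ω] φ ∧
    (p.2 : Rd d → Rd d) =ᵐ[volume.restrict Ω] gradient φ}

/-- A linear second-order (uniformly) elliptic operator on `Ω` with bounded measurable
coefficients, `𝓛 v = -div (A ∇v + v p) + q · ∇v + c v`. -/
structure EllipticOperator {d : ℕ} (Ω : Set (Rd d)) where
  A : Rd d → Rd d →L[ℝ] Rd d
  p : Rd d → Rd d
  q : Rd d → Rd d
  c : Rd d → ℝ
  memLp_A : MemLp A ∞ (volume.restrict Ω)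
  memLp_p : MemLp p ∞ (volume.restrict Ω)
  memLp_q : MemLp q ∞ (volume.restrict Ω)
  memLp_c : MemLp c ∞ (volume.restrict Ω)
  elliptic : ∃ θ : ℝ, 0 < θ ∧ ∀ᵐ x ∂(volume.restrict Ω), ∀ ξ : Rd d,
    θ * ‖ξ‖ ^ 2 ≤ inner ℝ (A x ξ) ξ

/-- `⟨𝓛 v, w⟩`, where `dv` and `dw` are the gradients of `v` and `w`. -/
def EllipticOperator.pairing {d : ℕ} {Ω : Set (Rd d)} (L : EllipticOperator Ω)
    (v : Rd d → ℝ) (dv : Rd d → Rd d) (w : Rd d → ℝ) (dw : Rd d → Rd d) : ℝ :=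
  ∫ x in Ω, (inner ℝ (L.A x (dv x)) (dw x) + v x * inner ℝ (L.p x) (dw x)
    + inner ℝ (L.q x) (dv x) * w x + L.c x * v x * w x)

/-- `v(·,t) ∈ H_0^1(Ω)`, and `(D_t^α + 𝓛) v(·,t) - f(·,t) = R` in `Ω` in the sense of
distributions, where `R ∈ L_2(Ω)`. -/
def HasResidualAt {d : ℕ} {Ω : Set (Rd d)} (L : EllipticOperator Ω) (α : ℝ)
    (f : Rd d → ℝ → ℝ) (v : ℝ → L2 Ω) (t : ℝ) (R : L2 Ω) : Prop :=
  ∃ dv : L2Vec Ω, (v t, dv) ∈ H01 Ω ∧ ∀ φ : Rd d → ℝ, IsTest Ω φ →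
    (∫ x in Ω, caputo α v t x * φ x) + L.pairing (v t) dv φ (gradient φ)
      - (∫ x in Ω, f x t * φ x) = ∫ x in Ω, R x * φ x

/-- `u` solves `D_t^α u + 𝓛 u = f` in `Ω × (0,T]`, `u(·,0) = u0` in `Ω`, `u = 0` on `∂Ω` for
`t > 0`. -/
def IsSolution {d : ℕ} {Ω : Set (Rd d)} (L : EllipticOperator Ω) (α T : ℝ)
    (f : Rd d → ℝ → ℝ) (u0 : L2 Ω) (u : ℝ → L2 Ω) : Prop :=
  u 0 = u0 ∧ ∀ t ∈ Ioc 0 T, HasResidualAt L α f u t 0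

end

/-! Write `e = u_h - u`. The energy identity for `e`, together with the fractional chain inequality
`‖e‖ D^α ‖e‖ ≤ ⟨D^α e, e⟩`, gives the scalar inequality `(D^α + λ) ‖e‖ ≤ ‖R_h‖`, which has to be
inverted. Let `K` be the kernel of `(D^α + λ)⁻¹` and `k` that of `J^(1-α)`. Term by term in the
Mittag-Leffler series, `K * (k + λ) = 1`, so `K * (D^α + λ) w = w` for Lipschitz `w` with
`w(0) = 0`. Moreover `K ≥ 0`: for `λ ≤ 0` every term of its series is nonnegative, and for `λ ≥ 0`
it is the derivative of the step response, which a minimum principle for `D^α + λ` shows to be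
monotone. Since `‖e‖` is only bounded near `t = 0`, the inversion is started at a time `ε > 0`.
The history on `(0, ε)` then contributes at most `‖e‖_∞ ∫_ε^t K(t - τ) (k(τ - ε) - k(τ)) dτ`,
which tends to `0` with `ε`. -/

open Filter Topology

/-- The kernel `r ↦ r^(b-1) / Γ(b)` of the Riemann–Liouville integral of order `b`. -/
noncomputable def powKernel (b r : ℝ) : ℝ := (Real.Gamma b)⁻¹ * r ^ (b - 1)

theorem powKernel_nonneg {b r : ℝ} (hb : 0 < b) (hr : 0 ≤ r) : 0 ≤ powKernel b r :=
  mul_nonneg (inv_pos.2 (Real.Gamma_pos_of_pos hb)).le (Real.rpow_nonneg hr _)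

theorem powKernel_one (r : ℝ) : powKernel 1 r = 1 := by simp [powKernel]

theorem intervalIntegrable_powKernel {b : ℝ} (hb : 0 < b) (s t : ℝ) :
    IntervalIntegrable (powKernel b) volume s t :=
  (intervalIntegral.intervalIntegrable_rpow' (by linarith)).const_mul _

theorem integral_rpow_mul_rpow_sub {a b t : ℝ} (ha : 0 < a) (hb : 0 < b) (ht : 0 < t) :
    ∫ s in (0 : ℝ)..t, s ^ (a - 1) * (t - s) ^ (b - 1)
      = t ^ (a + b - 1) * (Real.Gamma a * Real.Gamma b / Real.Gamma (a + b)) := by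
  have h := Complex.betaIntegral_scaled (a : ℂ) (b : ℂ) ht
  rw [Complex.betaIntegral_eq_Gamma_mul_div _ _ (by simpa) (by simpa), ← Complex.ofReal_add,
    Complex.Gamma_ofReal, Complex.Gamma_ofReal, Complex.Gamma_ofReal] at h
  apply Complex.ofReal_injective
  rw [← intervalIntegral.integral_ofReal]
  push_cast
  rw [Complex.ofReal_cpow ht.le]
  push_cast at h ⊢
  rw [← h]
  refine intervalIntegral.integral_congr fun s hs => ?_
  rw [uIcc_of_le ht.le] at hs
  simp only [Complex.ofReal_cpow hs.1, Complex.ofReal_cpow (sub_nonneg.2 hs.2)]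
  push_cast
  rfl

/-- Near each endpoint one of the two factors is bounded. -/
theorem intervalIntegrable_powKernel_sub_mul {a b t : ℝ} (ha : 0 < a) (hb : 0 < b) (ht : 0 < t) :
    IntervalIntegrable (fun s => powKernel a (t - s) * powKernel b s) volume 0 t := by
  have left_half : ∀ {a b : ℝ}, 0 < b →
      IntervalIntegrable (fun s => powKernel a (t - s) * powKernel b s) volume 0 (t / 2) := by
    intro a b hb
    refine (intervalIntegrable_powKernel hb _ _).continuousOn_mul fun s hs => ?_
    rw [uIcc_of_le (by linarith)] at hs
    exact (((continuousAt_const.sub continuousAt_id).rpow_const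
      (Or.inl (by simp; linarith [hs.2]))).const_mul _).continuousWithinAt
  refine (left_half hb).trans ?_
  have h := ((left_half (a := b) ha).comp_sub_left t).symm
  simpa [mul_comm, sub_half] using h

theorem integral_powKernel_sub_mul {a b t : ℝ} (ha : 0 < a) (hb : 0 < b) (ht : 0 < t) :
    ∫ s in (0 : ℝ)..t, powKernel a (t - s) * powKernel b s = powKernel (a + b) t := by
  have hGa := (Real.Gamma_pos_of_pos ha).ne'
  have hGb := (Real.Gamma_pos_of_pos hb).ne'
  calc ∫ s in (0 : ℝ)..t, powKernel a (t - s) * powKernel b s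
      = (Real.Gamma a)⁻¹ * (Real.Gamma b)⁻¹ *
          ∫ s in (0 : ℝ)..t, s ^ (b - 1) * (t - s) ^ (a - 1) := by
        rw [← intervalIntegral.integral_const_mul]
        refine intervalIntegral.integral_congr fun s _ => ?_
        simp only [powKernel]
        ring
    _ = powKernel (a + b) t := by
        rw [integral_rpow_mul_rpow_sub hb ha ht, powKernel, add_comm b a]
        field_simp

/-! ### Mittag-Leffler kernels -/

theorem rpow_mul_Gamma_le {x a : ℝ} (hx : 1 < x) (ha : 0 < a) :
    (x - 1) ^ a * Real.Gamma x ≤ Real.Gamma (x + a) := by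
  have hx1 : 0 < x - 1 := by linarith
  have hG := Real.Gamma_pos_of_pos hx1
  have hG' := Real.Gamma_pos_of_pos (by linarith : 0 < x)
  have hGx : Real.Gamma x = (x - 1) * Real.Gamma (x - 1) := by
    simpa using Real.Gamma_add_one hx1.ne'
  have slope := Real.convexOn_log_Gamma.slope_mono_adjacent (x := x - 1) (y := x) (z := x + a)
    hx1 (by simp only [mem_Ioi]; linarith) (by linarith) (by linarith)
  have log_ratio : Real.log (Real.Gamma x) - Real.log (Real.Gamma (x - 1)) = Real.log (x - 1) := by
    rw [hGx, Real.log_mul hx1.ne' hG.ne', add_sub_cancel_right]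
  simp only [Function.comp_apply, sub_sub_cancel, div_one, add_sub_cancel_left, log_ratio,
    le_div_iff₀ ha] at slope
  rw [← Real.log_le_log_iff (by positivity) (Real.Gamma_pos_of_pos (by linarith)),
    Real.log_mul (by positivity) hG'.ne', Real.log_rpow hx1]
  linarith

theorem summable_mittagLeffler {α : ℝ} (hα : 0 < α) (β z : ℝ) :
    Summable fun k : ℕ => (Real.Gamma (α * k + β))⁻¹ * z ^ k := by
  have hx : Tendsto (fun k : ℕ => α * (k : ℝ) + β) atTop atTop :=
    tendsto_atTop_add_const_right _ _ (tendsto_natCast_atTop_atTop.const_mul_atTop hα)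
  have hpow : Tendsto (fun k : ℕ => (α * (k : ℝ) + β - 1) ^ α) atTop atTop :=
    (tendsto_rpow_atTop hα).comp (tendsto_atTop_add_const_right _ (-1) hx)
  refine summable_of_ratio_norm_eventually_le (r := 1 / 2) (by norm_num) ?_
  filter_upwards [hpow.eventually_ge_atTop (2 * |z|), hx.eventually_gt_atTop 1] with k hk1 hk2
  have hG := Real.Gamma_pos_of_pos (by linarith : 0 < α * (k : ℝ) + β)
  have hG2 := Real.Gamma_pos_of_pos (by linarith : 0 < α * (k : ℝ) + β + α)
  have ratio : 2 * |z| * Real.Gamma (α * k + β) ≤ Real.Gamma (α * k + β + α) :=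
    (mul_le_mul_of_nonneg_right hk1 hG.le).trans (rpow_mul_Gamma_le hk2 hα)
  have e : α * ((k + 1 : ℕ) : ℝ) + β = α * (k : ℝ) + β + α := by push_cast; ring
  simp only [e, norm_mul, norm_pow, pow_succ, norm_inv, Real.norm_eq_abs, abs_of_pos hG,
    abs_of_pos hG2]
  calc (Real.Gamma (α * k + β + α))⁻¹ * (|z| ^ k * |z|)
      = (2 * |z| * Real.Gamma (α * k + β)) * (Real.Gamma (α * k + β + α))⁻¹ *
          (1 / 2 * ((Real.Gamma (α * k + β))⁻¹ * |z| ^ k)) := by field_simp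
    _ ≤ 1 * (1 / 2 * ((Real.Gamma (α * k + β))⁻¹ * |z| ^ k)) := by
        gcongr
        rwa [← div_eq_mul_inv, div_le_one hG2]
    _ = 1 / 2 * ((Real.Gamma (α * k + β))⁻¹ * |z| ^ k) := one_mul _

theorem continuous_mittagLeffler {α : ℝ} (hα : 0 < α) (β : ℝ) :
    Continuous (mittagLeffler α β) := by
  refine continuous_iff_continuousAt.2 fun z => ?_
  have h : ContinuousOn (mittagLeffler α β) (Metric.ball 0 (|z| + 1)) := by
    refine continuousOn_tsum (u := fun k : ℕ => ‖(Real.Gamma (α * k + β))⁻¹ * (|z| + 1) ^ k‖)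
      (fun k => by fun_prop) (summable_mittagLeffler hα β _).norm fun k y hy => ?_
    rw [mem_ball_zero_iff] at hy
    rw [norm_mul, norm_mul, norm_pow, norm_pow, Real.norm_of_nonneg (by positivity : 0 ≤ |z| + 1)]
    gcongr
  exact h.continuousAt (Metric.isOpen_ball.mem_nhds (by simp))

/-- The kernel `r ↦ r^(β-1) E_{α,β}(-λ r^α)`, whose Laplace transform is `z^(α-β) / (z^α + λ)`.
The family in `β` is closed under convolution with `powKernel γ`, and `β = α` is the kernel
`resolventKernel α λ` of `(D_t^α + λ)⁻¹`. -/
noncomputable def mlKernel (α β lam r : ℝ) : ℝ :=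
  r ^ (β - 1) * mittagLeffler α β (-lam * r ^ α)

section MittagLefflerKernel

variable {α β γ r t : ℝ} (lam : ℝ)

theorem resolventKernel_eq_mlKernel (α : ℝ) : resolventKernel α lam = mlKernel α α lam := rfl

theorem hasSum_mlKernel (hα : 0 < α) (hr : 0 < r) :
    HasSum (fun j : ℕ => (-lam) ^ j * powKernel (α * j + β) r) (mlKernel α β lam r) := by
  refine (((summable_mittagLeffler hα β (-lam * r ^ α)).hasSum).mul_left (r ^ (β - 1))).congr_fun
    fun j => ?_
  have e : r ^ (α * (j : ℝ) + β - 1) = r ^ (β - 1) * (r ^ α) ^ j := by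
    rw [← Real.rpow_natCast, ← Real.rpow_mul hr.le, ← Real.rpow_add hr]
    ring_nf
  rw [powKernel, e, mul_pow]
  ring

theorem continuousOn_mlKernel (hα : 0 < α) : ContinuousOn (mlKernel α β lam) (Ioi 0) := by
  have := continuous_mittagLeffler hα β
  unfold mlKernel
  fun_prop (disch := grind)

theorem intervalIntegrable_mlKernel (hα : 0 < α) (hβ : 0 < β) (s t : ℝ) :
    IntervalIntegrable (mlKernel α β lam) volume s t :=
  (intervalIntegral.intervalIntegrable_rpow' (by linarith)).mul_continuousOn
    ((continuous_mittagLeffler hα β).comp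
      ((Real.continuous_rpow_const hα.le).const_mul _)).continuousOn

theorem intervalIntegrable_mlKernel_sub_mul (hα : 0 < α) (hβ : 0 < β) (hγ : 0 < γ) (ht : 0 < t) :
    IntervalIntegrable (fun s => mlKernel α β lam (t - s) * powKernel γ s) volume 0 t := by
  have hG := (Real.Gamma_pos_of_pos hβ).ne'
  have hE : Continuous fun s => Real.Gamma β * mittagLeffler α β (-lam * (t - s) ^ α) :=
    ((continuous_mittagLeffler hα β).comp (((Real.continuous_rpow_const hα.le).comp
      (continuous_const.sub continuous_id)).const_mul _)).const_mul _
  refine ((intervalIntegrable_powKernel_sub_mul hβ hγ ht).continuousOn_mul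
    hE.continuousOn).congr fun s _ => ?_
  simp only [mlKernel, powKernel]
  field_simp

theorem mlKernel_add_lam_mul_mlKernel (hα : 0 < α) (hr : 0 < r) :
    mlKernel α β lam r + lam * mlKernel α (α + β) lam r = powKernel β r := by
  have tail : HasSum (fun j : ℕ => (-lam) ^ (j + 1) * powKernel (α * (j + 1 : ℕ) + β) r)
      (-lam * mlKernel α (α + β) lam r) := by
    refine ((hasSum_mlKernel lam hα hr).mul_left (-lam)).congr_fun fun j => ?_
    push_cast
    ring_nf
  have h := tail.unique ((hasSum_nat_add_iff' 1).2 (hasSum_mlKernel (β := β) lam hα hr))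
  simp only [neg_mul, Finset.range_one, Finset.sum_singleton, pow_zero, CharP.cast_eq_zero,
    mul_zero, zero_add, one_mul] at h
  linarith

theorem integral_mlKernel_sub_mul_powKernel (hα : 0 < α) (hβ : 0 < β) (hγ : 0 < γ) (ht : 0 < t) :
    ∫ s in (0 : ℝ)..t, mlKernel α β lam (t - s) * powKernel γ s = mlKernel α (β + γ) lam t := by
  set F : ℕ → ℝ → ℝ := fun j s => (-lam) ^ j * (powKernel (α * j + β) (t - s) * powKernel γ s)
    with hF
  have hpos : ∀ j : ℕ, 0 < α * (j : ℝ) + β := fun j => by positivity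
  have hint : ∀ j, IntegrableOn (F j) (Ioo 0 t) := fun j =>
    (intervalIntegrable_iff_integrableOn_Ioo_of_le ht.le).1
      ((intervalIntegrable_powKernel_sub_mul (hpos j) hγ ht).const_mul _)
  have hval : ∀ (j : ℕ) (c : ℝ), ∫ s in Ioo 0 t, c * (powKernel (α * j + β) (t - s) *
      powKernel γ s) = c * powKernel (α * j + (β + γ)) t := fun j c => by
    rw [integral_const_mul, ← integral_Ioc_eq_integral_Ioo, ← intervalIntegral.integral_of_le ht.le,
      integral_powKernel_sub_mul (hpos j) hγ ht, add_assoc]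
  have hnorm : ∀ j : ℕ, ∫ s in Ioo 0 t, ‖F j s‖
      = (- -|lam|) ^ j * powKernel (α * j + (β + γ)) t := fun j => by
    rw [← hval]
    refine setIntegral_congr_fun measurableSet_Ioo fun s hs => ?_
    have := powKernel_nonneg (hpos j) (sub_pos.2 hs.2).le
    have := powKernel_nonneg hγ hs.1.le
    simp only [hF, norm_mul, norm_pow, norm_neg, neg_neg, Real.norm_eq_abs]
    rw [abs_of_nonneg ‹0 ≤ powKernel γ s›, abs_of_nonneg ‹0 ≤ powKernel _ (t - s)›]
  have hsum : Summable fun j => ∫ s in Ioo 0 t, ‖F j s‖ := by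
    simpa only [hnorm] using (hasSum_mlKernel (-|lam|) hα ht).summable
  have h := hasSum_integral_of_summable_integral_norm hint hsum
  simp only [hF, hval] at h
  rw [← h.unique (hasSum_mlKernel lam hα ht), intervalIntegral.integral_of_le ht.le,
    integral_Ioc_eq_integral_Ioo]
  refine setIntegral_congr_fun measurableSet_Ioo fun s hs => ?_
  refine (((hasSum_mlKernel lam hα (sub_pos.2 hs.2)).mul_right (powKernel γ s)).congr_fun
    fun j => ?_).tsum_eq.symm
  ring

/-- `K * (k + λ) = 1` for the kernels `K` of `(D_t^α + λ)⁻¹` and `k` of `J^(1-α)`. -/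
theorem integral_resolventKernel_sub_mul (hα0 : 0 < α) (hα1 : α < 1) (ht : 0 < t) :
    ∫ s in (0 : ℝ)..t, resolventKernel α lam (t - s) * (powKernel (1 - α) s + lam) = 1 := by
  have h1 := integral_mlKernel_sub_mul_powKernel lam hα0 hα0 (sub_pos.2 hα1) ht
  have h2 := integral_mlKernel_sub_mul_powKernel lam hα0 hα0 one_pos ht
  have i1 := intervalIntegrable_mlKernel_sub_mul lam hα0 hα0 (sub_pos.2 hα1) ht
  have i2 := intervalIntegrable_mlKernel_sub_mul lam hα0 hα0 one_pos ht
  have h := mlKernel_add_lam_mul_mlKernel (β := 1) lam hα0 ht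
  simp only [powKernel_one, mul_one] at h2 i2 h
  simp only [resolventKernel_eq_mlKernel, mul_add]
  rw [intervalIntegral.integral_add i1 (i2.mul_const lam), intervalIntegral.integral_mul_const,
    h1, h2, add_sub_cancel, mul_comm _ lam, h]

end MittagLefflerKernel

/-! ### Convolution on a bounded interval -/

section Convolution

open scoped Convolution

variable {φ ψ g : ℝ → ℝ} {t T C : ℝ}

theorem convolution_indicator_left (φ ψ : ℝ → ℝ) (hT : 0 ≤ T) :
    ((Ioo 0 T).indicator φ ⋆[.mul ℝ ℝ, volume] ψ) T = ∫ s in (0 : ℝ)..T, φ (T - s) * ψ s := by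
  rw [convolution_eq_swap, intervalIntegral.integral_of_le hT, integral_Ioc_eq_integral_Ioo,
    ← integral_indicator measurableSet_Ioo]
  congr 1 with s
  by_cases h : s ∈ Ioo 0 T
  · have : T - s ∈ Ioo 0 T := by grind
    simp [h, this]
  · have : T - s ∉ Ioo 0 T := by grind
    simp [h, this]

theorem convolution_indicator_right (φ ψ : ℝ → ℝ) (hT : 0 ≤ T) :
    (φ ⋆[.mul ℝ ℝ, volume] (Ioo 0 T).indicator ψ) T = ∫ s in (0 : ℝ)..T, φ (T - s) * ψ s := by
  rw [convolution_eq_swap, intervalIntegral.integral_of_le hT, integral_Ioc_eq_integral_Ioo,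
    ← integral_indicator measurableSet_Ioo]
  congr 1 with s
  by_cases h : s ∈ Ioo 0 T <;> simp [h]

theorem convolution_indicator_indicator (φ ψ : ℝ → ℝ) (ht : t ∈ Icc 0 T) :
    ((Ioo 0 T).indicator φ ⋆[.mul ℝ ℝ, volume] (Ioo 0 T).indicator ψ) t
      = ∫ s in (0 : ℝ)..t, φ (t - s) * ψ s := by
  rw [← convolution_indicator_right φ ψ ht.1, convolution_eq_swap, convolution_eq_swap]
  congr 1 with s
  have := ht.2
  by_cases h : s ∈ Ioo 0 t
  · have h1 : t - s ∈ Ioo 0 T := by grind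
    have h2 : s ∈ Ioo 0 T := by grind
    simp [h, h1, h2]
  · have : t - s ∉ Ioo 0 T ∨ s ∉ Ioo 0 T := by grind
    rcases this with h1 | h1 <;> simp [h, h1]

theorem convolutionExistsAt_convolution_of_bounded (hφ : Integrable φ) (hψ : Integrable ψ)
    (hg : Integrable g) (hC : ∀ s, ‖g s‖ ≤ C) (x : ℝ) :
    ConvolutionExistsAt φ (ψ ⋆[.mul ℝ ℝ, volume] g) x (.mul ℝ ℝ) := by
  refine hφ.mul_bdd (c := ∫ y, ‖ψ y‖ * C) ?_ (Eventually.of_forall fun s => ?_)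
  · have := (hψ.integrable_convolution (.mul ℝ ℝ) hg).aestronglyMeasurable
    exact this.comp_quasiMeasurePreserving (quasiMeasurePreserving_sub_left volume x)
  · refine (norm_integral_le_integral_norm _).trans ?_
    refine integral_mono_of_nonneg (Eventually.of_forall fun y => norm_nonneg _)
      (hψ.norm.mul_const C) (Eventually.of_forall fun y => ?_)
    simpa using mul_le_mul_of_nonneg_left (hC _) (abs_nonneg _)

theorem abs_indicator_le_abs (hC : ∀ s ∈ Ioo 0 T, |g s| ≤ C) (s : ℝ) :
    |(Ioo 0 T).indicator g s| ≤ |C| := by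
  by_cases hs : s ∈ Ioo 0 T
  · simpa [hs] using (hC s hs).trans (le_abs_self C)
  · simp [hs]

theorem intervalIntegrable_mul_integral (hT : 0 ≤ T) (hφ : IntegrableOn φ (Ioo 0 T))
    (hψ : IntegrableOn ψ (Ioo 0 T)) (hg : IntegrableOn g (Ioo 0 T))
    (hC : ∀ s ∈ Ioo 0 T, |g s| ≤ C) :
    IntervalIntegrable (fun s => φ (T - s) * ∫ r in (0 : ℝ)..s, ψ (s - r) * g r) volume 0 T := by
  rw [intervalIntegrable_iff_integrableOn_Ioo_of_le hT]
  have h := convolutionExistsAt_convolution_of_bounded (hφ.integrable_indicator measurableSet_Ioo)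
    (hψ.integrable_indicator measurableSet_Ioo) (hg.integrable_indicator measurableSet_Ioo)
    (abs_indicator_le_abs hC) T
  refine h.integrable_swap.integrableOn.congr_fun (fun s hs => ?_) measurableSet_Ioo
  have : T - s ∈ Ioo 0 T := by grind
  simp [this, convolution_indicator_indicator ψ g (Ioo_subset_Icc_self hs)]

theorem integral_mul_integral_assoc (hT : 0 ≤ T) (hφ : IntegrableOn φ (Ioo 0 T))
    (hψ : IntegrableOn ψ (Ioo 0 T)) (hg : IntegrableOn g (Ioo 0 T))
    (hC : ∀ s ∈ Ioo 0 T, |g s| ≤ C) :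
    ∫ s in (0 : ℝ)..T, φ (T - s) * ∫ r in (0 : ℝ)..s, ψ (s - r) * g r
      = ∫ r in (0 : ℝ)..T, (∫ s in (0 : ℝ)..T - r, φ (T - r - s) * ψ s) * g r := by
  set I : (ℝ → ℝ) → ℝ → ℝ := (Ioo 0 T).indicator with hI
  have hφ' : Integrable (I φ) := hφ.integrable_indicator measurableSet_Ioo
  have hψ' : Integrable (I ψ) := hψ.integrable_indicator measurableSet_Ioo
  have hg' : Integrable (I g) := hg.integrable_indicator measurableSet_Ioo
  have assoc := convolution_assoc (L := .mul ℝ ℝ) (L₂ := .mul ℝ ℝ) (L₃ := .mul ℝ ℝ)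
    (L₄ := .mul ℝ ℝ) (fun x y z => mul_assoc x y z) (x₀ := T) hφ'.aestronglyMeasurable
    hψ'.aestronglyMeasurable hg'.aestronglyMeasurable
    (hφ'.ae_convolution_exists _ hψ') (hψ'.norm.ae_convolution_exists _ hg'.norm)
    (convolutionExistsAt_convolution_of_bounded hφ'.norm hψ'.norm hg'.norm (C := |C|)
      (fun s => (norm_norm _).trans_le (abs_indicator_le_abs hC s)) T)
  rw [convolution_indicator_right _ _ hT, convolution_indicator_left _ _ hT] at assoc
  calc ∫ s in (0 : ℝ)..T, φ (T - s) * ∫ r in (0 : ℝ)..s, ψ (s - r) * g r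
      = ∫ s in (0 : ℝ)..T, φ (T - s) * (I ψ ⋆[.mul ℝ ℝ, volume] I g) s :=
        intervalIntegral.integral_congr fun s hs => by
          rw [uIcc_of_le hT] at hs
          simp only [hI, convolution_indicator_indicator ψ g hs]
    _ = ∫ r in (0 : ℝ)..T, (I φ ⋆[.mul ℝ ℝ, volume] I ψ) (T - r) * g r := assoc.symm
    _ = _ := intervalIntegral.integral_congr fun r hr => by
        rw [uIcc_of_le hT] at hr
        simp only [hI, convolution_indicator_indicator φ ψ
          ⟨sub_nonneg.2 hr.2, sub_le_self T hr.1⟩]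

end Convolution

/-! ### The Caputo derivative -/

/-- The singular integral in the integrated-by-parts form of `caputo α v t` converges. -/
def CaputoIntegrableAt {X : Type*} [NormedAddCommGroup X] [NormedSpace ℝ X]
    (α : ℝ) (v : ℝ → X) (t : ℝ) : Prop :=
  IntervalIntegrable (fun s => (α * (t - s) ^ (-α - 1)) • (v t - v s)) volume 0 t

/-- The Riemann–Liouville derivative of order `α ∈ (0,1)`, in the integrated-by-parts form
corresponding to `caputo`. Unlike the Caputo derivative it does not subtract the initial value,
which makes it behave well under a change of the initial time. -/
noncomputable def rlDeriv {X : Type*} [NormedAddCommGroup X] [NormedSpace ℝ X]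
    (α : ℝ) (v : ℝ → X) (t : ℝ) : X :=
  (Real.Gamma (1 - α))⁻¹ •
    (t ^ (-α) • v t + ∫ s in (0 : ℝ)..t, (α * (t - s) ^ (-α - 1)) • (v t - v s))

section Caputo

variable {X : Type*} [NormedAddCommGroup X] [NormedSpace ℝ X] {α ε t : ℝ}

theorem rlDeriv_eq_caputo_add (v : ℝ → X) :
    rlDeriv α v t = caputo α v t + powKernel (1 - α) t • v 0 := by
  simp only [rlDeriv, caputo, powKernel, show 1 - α - 1 = -α by ring]
  module

theorem continuousOn_caputo_weight (α : ℝ) (hε : ε < t) :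
    ContinuousOn (fun s : ℝ => α * (t - s) ^ (-α - 1)) (Icc 0 ε) := fun s hs =>
  (((continuousAt_const.sub continuousAt_id).rpow_const
    (Or.inl (by simp; linarith [hs.2]))).const_mul α).continuousWithinAt

theorem CaputoIntegrableAt.of_isBigO (hα : α < 1) (ht : 0 < t) {v : ℝ → X}
    (hv : IntegrableOn v (Ioo 0 t)) (hO : (fun s => v t - v s) =O[𝓝[<] t] fun s => t - s) :
    CaputoIntegrableAt α v t := by
  have hIoo : Ioo 0 t ∈ 𝓝[<] t := Ioo_mem_nhdsLT ht
  have weighted : (fun s => (α * (t - s) ^ (-α - 1)) • (v t - v s))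
      =O[𝓝[<] t] fun s => (t - s) ^ (-α) := by
    refine (((Asymptotics.isBigO_refl (fun s : ℝ => (t - s) ^ (-α - 1)) _).const_mul_left α).smul
      hO).congr' .rfl ?_
    filter_upwards [self_mem_nhdsWithin] with s hs
    rw [smul_eq_mul, Real.rpow_sub_one (sub_pos.2 hs).ne', div_mul_cancel₀ _ (sub_pos.2 hs).ne']
  have dominant : IntegrableOn (fun s => (t - s) ^ (-α)) (Ioo 0 t) := by
    have h := ((intervalIntegral.intervalIntegrable_rpow' (a := 0) (b := t)
      (by linarith : -1 < -α)).comp_sub_left t).symm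
    rwa [sub_self, sub_zero, intervalIntegrable_iff_integrableOn_Ioo_of_le ht.le] at h
  have hmeas : AEStronglyMeasurable (fun s => (α * (t - s) ^ (-α - 1)) • (v t - v s))
      (volume.restrict (Ioo 0 t)) :=
    (Measurable.aestronglyMeasurable (by fun_prop)).smul
      (aestronglyMeasurable_const.sub hv.aestronglyMeasurable)
  obtain ⟨A, hA, hint⟩ := weighted.integrableAtFilter ⟨_, hIoo, hmeas⟩ ⟨_, hIoo, dominant⟩
  obtain ⟨ε, hε, hεA⟩ := (mem_nhdsLT_iff_exists_mem_Ico_Ioo_subset ht).1 hA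
  have far : IntervalIntegrable (fun s => (α * (t - s) ^ (-α - 1)) • (v t - v s)) volume 0 ε := by
    refine IntervalIntegrable.continuousOn_smul ?_
      (uIcc_of_le hε.1 ▸ continuousOn_caputo_weight α hε.2)
    refine intervalIntegrable_const.sub ?_
    exact (intervalIntegrable_iff_integrableOn_Ioo_of_le hε.1).2
      (hv.mono_set (Ioo_subset_Ioo_right hε.2.le))
  exact far.trans ((intervalIntegrable_iff_integrableOn_Ioo_of_le hε.2.le).2 (hint.mono_set hεA))

theorem caputo_sub {v w : ℝ → X} (hv : CaputoIntegrableAt α v t) (hw : CaputoIntegrableAt α w t) :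
    caputo α (fun s => v s - w s) t = caputo α v t - caputo α w t := by
  have h : ∫ s in (0 : ℝ)..t, (α * (t - s) ^ (-α - 1)) • (v t - w t - (v s - w s))
      = (∫ s in (0 : ℝ)..t, (α * (t - s) ^ (-α - 1)) • (v t - v s))
        - ∫ s in (0 : ℝ)..t, (α * (t - s) ^ (-α - 1)) • (w t - w s) := by
    rw [← intervalIntegral.integral_sub hv hw]
    refine intervalIntegral.integral_congr fun s _ => ?_
    module
  simp only [caputo, h]
  module

theorem caputo_le_of_forall_le (hα0 : 0 < α) (hα1 : α < 1) (ht : 0 ≤ t) {v : ℝ → ℝ}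
    (hmin : ∀ s ∈ Ioo 0 t, v t ≤ v s) :
    caputo α v t ≤ powKernel (1 - α) t * (v t - v 0) := by
  have hΓ := Real.Gamma_pos_of_pos (sub_pos.2 hα1)
  have history : ∫ s in (0 : ℝ)..t, (α * (t - s) ^ (-α - 1)) • (v t - v s) ≤ 0 := by
    rw [intervalIntegral.integral_of_le ht, integral_Ioc_eq_integral_Ioo]
    refine setIntegral_nonpos measurableSet_Ioo fun s hs => ?_
    have : 0 ≤ t - s := by linarith [hs.2]
    exact mul_nonpos_of_nonneg_of_nonpos (by positivity) (sub_nonpos.2 (hmin s hs))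
  rw [caputo, powKernel, show 1 - α - 1 = -α by ring, smul_eq_mul, smul_eq_mul, mul_assoc]
  exact mul_le_mul_of_nonneg_left (by linarith) (inv_pos.2 hΓ).le

theorem integral_smul_caputo_weight_sub [CompleteSpace X] {w : ℝ → X} (hε0 : 0 ≤ ε) (hεt : ε < t)
    (hw : CaputoIntegrableAt α w t) :
    ∫ s in (0 : ℝ)..ε, (α * (t - s) ^ (-α - 1)) • (w t - w s)
      = ((t - ε) ^ (-α) - t ^ (-α)) • w t
        - ∫ s in (0 : ℝ)..ε, (α * (t - s) ^ (-α - 1)) • w s := by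
  have hint : IntervalIntegrable (fun s => (α * (t - s) ^ (-α - 1)) • (w t - w s)) volume 0 ε :=
    hw.mono_set (uIcc_subset_uIcc_left (by grind [uIcc_of_le]))
  have hconst : IntervalIntegrable (fun s => (α * (t - s) ^ (-α - 1)) • w t) volume 0 ε :=
    ((uIcc_of_le hε0 ▸ continuousOn_caputo_weight α hεt).smul continuousOn_const).intervalIntegrable
  rw [← integral_caputo_weight hεt hε0, ← intervalIntegral.integral_smul_const, eq_sub_iff_add_eq,
    eq_comm, ← sub_eq_iff_eq_add', ← intervalIntegral.integral_sub hconst hint]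
  refine intervalIntegral.integral_congr fun s _ => ?_
  module

theorem rlDeriv_comp_add_right [CompleteSpace X] {w : ℝ → X} (hε0 : 0 ≤ ε) (hεt : ε < t)
    (hw : CaputoIntegrableAt α w t) :
    rlDeriv α (fun s => w (s + ε)) (t - ε) = rlDeriv α w t
      + (Real.Gamma (1 - α))⁻¹ • ∫ s in (0 : ℝ)..ε, (α * (t - s) ^ (-α - 1)) • w s := by
  have hmem : ε ∈ uIcc 0 t := by grind [uIcc_of_le]
  have split := intervalIntegral.integral_add_adjacent_intervals
    (hw.mono_set (uIcc_subset_uIcc_left hmem)) (hw.mono_set (uIcc_subset_uIcc_right hmem))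
  have shift := intervalIntegral.integral_comp_add_right (a := 0) (b := t - ε)
    (fun s => (α * (t - s) ^ (-α - 1)) • (w t - w s)) ε
  rw [zero_add, sub_add_cancel] at shift
  simp only [rlDeriv, sub_add_cancel, sub_sub, add_comm ε]
  rw [shift, ← split, integral_smul_caputo_weight_sub hε0 hεt hw]
  module

end Caputo

section VariationOfConstants

variable {α a b t : ℝ} {K : NNReal} {v : ℝ → ℝ}

theorem integral_deriv_of_lipschitzOnWith (hv : LipschitzOnWith K v (Icc a b)) (ha : t ∈ Icc a b) :
    ∫ s in t..b, deriv v s = v b - v t := by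
  have hac := (hv.mono (s := uIcc t b) (by grind [uIcc_of_le])).absolutelyContinuousOnInterval
  exact hac.integral_deriv_eq_sub

theorem abs_deriv_le_of_lipschitzOnWith (hv : LipschitzOnWith K v (Icc a b)) (ht : t ∈ Ioo a b) :
    |deriv v t| ≤ K :=
  norm_deriv_le_of_lipschitzOn (Icc_mem_nhds ht.1 ht.2) hv

theorem integrableOn_deriv_of_lipschitzOnWith (hv : LipschitzOnWith K v (Icc a b)) :
    IntegrableOn (deriv v) (Ioo a b) :=
  Measure.integrableOn_of_bounded measure_Ioo_lt_top.ne (measurable_deriv v).aestronglyMeasurable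
    ((ae_restrict_mem measurableSet_Ioo).mono fun _ => abs_deriv_le_of_lipschitzOnWith hv)

theorem intervalIntegrable_powKernel_sub_mul_deriv (hα1 : α < 1) (ht : 0 ≤ t)
    (hv : LipschitzOnWith K v (Icc 0 t)) :
    IntervalIntegrable (fun s => powKernel (1 - α) (t - s) * deriv v s) volume 0 t := by
  have h := ((intervalIntegrable_powKernel (sub_pos.2 hα1) 0 t).comp_sub_left t).symm
  rw [sub_self, sub_zero, intervalIntegrable_iff_integrableOn_Ioo_of_le ht] at h
  rw [intervalIntegrable_iff_integrableOn_Ioo_of_le ht]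
  exact h.mul_bdd (integrableOn_deriv_of_lipschitzOnWith hv).aestronglyMeasurable
    ((ae_restrict_mem measurableSet_Ioo).mono fun _ => abs_deriv_le_of_lipschitzOnWith hv)

theorem caputo_eq_integral_deriv (hα0 : 0 < α) (hα1 : α < 1) (ht : 0 < t)
    (hv : LipschitzOnWith K v (Icc 0 t)) :
    caputo α v t = ∫ s in (0 : ℝ)..t, powKernel (1 - α) (t - s) * deriv v s := by
  have hd := (intervalIntegrable_iff_integrableOn_Ioo_of_le ht.le).2
    (integrableOn_deriv_of_lipschitzOnWith hv)
  have hk : IntervalIntegrable (fun s => (t - s) ^ (-α) • deriv v s) volume 0 t := by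
    refine ((intervalIntegrable_powKernel_sub_mul_deriv hα1 ht.le hv).const_mul
      (Real.Gamma (1 - α))).congr fun s _ => ?_
    simp only [powKernel, smul_eq_mul, mul_assoc, sub_sub_cancel_left]
    exact mul_inv_cancel_left₀ (Real.Gamma_pos_of_pos (sub_pos.2 hα1)).ne' _
  rw [caputo_eq_fracInt hα0 ht hd hk
    fun s hs => (integral_deriv_of_lipschitzOnWith hv hs).symm]
  simp only [fracInt, powKernel, smul_eq_mul, mul_assoc, intervalIntegral.integral_const_mul,
    sub_sub_cancel_left]

theorem rlDeriv_add_mul_eq (lam : ℝ) (hα0 : 0 < α) (hα1 : α < 1) (ht : 0 < t)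
    (hv : LipschitzOnWith K v (Icc 0 t)) :
    rlDeriv α v t + lam * v t = (powKernel (1 - α) t + lam) * v 0
      + ∫ s in (0 : ℝ)..t, (powKernel (1 - α) (t - s) + lam) * deriv v s := by
  have hd := (intervalIntegrable_iff_integrableOn_Ioo_of_le ht.le).2
    (integrableOn_deriv_of_lipschitzOnWith hv)
  have ftc := integral_deriv_of_lipschitzOnWith hv (left_mem_Icc.2 ht.le)
  simp only [add_mul]
  rw [intervalIntegral.integral_add
    (intervalIntegrable_powKernel_sub_mul_deriv hα1 ht.le hv) (hd.const_mul lam),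
    intervalIntegral.integral_const_mul, ftc, rlDeriv_eq_caputo_add,
    caputo_eq_integral_deriv hα0 hα1 ht hv, smul_eq_mul]
  ring

theorem eq_integral_resolventKernel_mul (lam : ℝ) (hα0 : 0 < α) (hα1 : α < 1) (ht : 0 < t)
    (hv : LipschitzOnWith K v (Icc 0 t)) :
    v t = ∫ s in (0 : ℝ)..t, resolventKernel α lam (t - s) * (rlDeriv α v s + lam * v s) := by
  set ψ : ℝ → ℝ := fun s => powKernel (1 - α) s + lam
  have resolvent : ∀ {τ}, 0 < τ → ∫ s in (0 : ℝ)..τ, resolventKernel α lam (τ - s) * ψ s = 1 :=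
    integral_resolventKernel_sub_mul lam hα0 hα1
  have iK : IntegrableOn (resolventKernel α lam) (Ioo 0 t) :=
    (intervalIntegrable_iff_integrableOn_Ioo_of_le ht.le).1
      (intervalIntegrable_mlKernel lam hα0 hα0 0 t)
  have iψ : IntegrableOn ψ (Ioo 0 t) :=
    (intervalIntegrable_iff_integrableOn_Ioo_of_le ht.le).1
      ((intervalIntegrable_powKernel (sub_pos.2 hα1) 0 t).add intervalIntegrable_const)
  have id := integrableOn_deriv_of_lipschitzOnWith hv
  have bd : ∀ s ∈ Ioo 0 t, |deriv v s| ≤ K := fun _ => abs_deriv_le_of_lipschitzOnWith hv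
  have iKψ : IntervalIntegrable (fun s => resolventKernel α lam (t - s) * ψ s) volume 0 t :=
    intervalIntegral.intervalIntegrable_of_integral_ne_zero (by simp [resolvent ht])
  symm
  calc ∫ s in (0 : ℝ)..t, resolventKernel α lam (t - s) * (rlDeriv α v s + lam * v s)
      = ∫ s in (0 : ℝ)..t, (resolventKernel α lam (t - s) * ψ s * v 0
          + resolventKernel α lam (t - s) * ∫ r in (0 : ℝ)..s, ψ (s - r) * deriv v r) := by
        refine intervalIntegral.integral_congr_Ioo_of_le ht.le fun s hs => ?_
        rw [rlDeriv_add_mul_eq lam hα0 hα1 hs.1 (hv.mono (Icc_subset_Icc_right hs.2.le))]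
        ring
    _ = v 0 + ∫ r in (0 : ℝ)..t,
          (∫ s in (0 : ℝ)..t - r, resolventKernel α lam (t - r - s) * ψ s) * deriv v r := by
        rw [intervalIntegral.integral_add (iKψ.mul_const _)
          (intervalIntegrable_mul_integral ht.le iK iψ id bd), intervalIntegral.integral_mul_const,
          resolvent ht, one_mul, integral_mul_integral_assoc ht.le iK iψ id bd]
    _ = v 0 + ∫ r in (0 : ℝ)..t, deriv v r := by
        congr 1
        refine intervalIntegral.integral_congr_Ioo_of_le ht.le fun r hr => ?_
        rw [resolvent (sub_pos.2 hr.2), one_mul]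
    _ = v t := by
        rw [integral_deriv_of_lipschitzOnWith hv (left_mem_Icc.2 ht.le), add_sub_cancel]

end VariationOfConstants

section Positivity

variable {α h t T : ℝ}

theorem nonneg_of_forall_caputo_add_nonneg {lam : ℝ} (hα0 : 0 < α) (hα1 : α < 1) (hlam : 0 ≤ lam)
    {v : ℝ → ℝ} (hv : ContinuousOn v (Icc 0 T)) (h0 : 0 ≤ v 0)
    (h : ∀ t ∈ Ioc 0 T, 0 ≤ caputo α v t + lam * v t) : ∀ t ∈ Icc 0 T, 0 ≤ v t := by
  intro t ht
  obtain ⟨m, hm, hmin⟩ := isCompact_Icc.exists_isMinOn ⟨t, ht⟩ hv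
  refine le_trans ?_ (hmin ht)
  by_contra! hneg
  have m_pos : 0 < m := hm.1.lt_of_ne fun e => by rw [← e] at hneg; linarith
  have le := caputo_le_of_forall_le hα0 hα1 hm.1 fun s hs =>
    hmin ⟨hs.1.le, hs.2.le.trans hm.2⟩
  have kernel_pos : 0 < powKernel (1 - α) m :=
    mul_pos (inv_pos.2 (Real.Gamma_pos_of_pos (sub_pos.2 hα1))) (Real.rpow_pos_of_pos m_pos _)
  nlinarith [h m ⟨m_pos, hm.2⟩]

theorem caputo_congr {v w : ℝ → ℝ} (ht : 0 ≤ t) (h : EqOn v w (Icc 0 t)) :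
    caputo α v t = caputo α w t := by
  have hint : ∫ s in (0 : ℝ)..t, (α * (t - s) ^ (-α - 1)) • (v t - v s)
      = ∫ s in (0 : ℝ)..t, (α * (t - s) ^ (-α - 1)) • (w t - w s) :=
    intervalIntegral.integral_congr fun s hs => by
      simp only [h (right_mem_Icc.2 ht), h (uIcc_of_le ht ▸ hs)]
  rw [caputo, caputo, hint, h (left_mem_Icc.2 ht), h (right_mem_Icc.2 ht)]

/-- The solution of `D^α y + lam y = 1`, `y 0 = 0`, extended by zero to negative times. Its
derivative is the resolvent kernel, and its monotonicity gives the positivity of that kernel. -/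
noncomputable def stepResponse (α lam t : ℝ) : ℝ :=
  ∫ s in (0 : ℝ)..max t 0, resolventKernel α lam s

variable (lam : ℝ)

theorem stepResponse_of_nonpos (α : ℝ) (ht : t ≤ 0) : stepResponse α lam t = 0 := by
  simp [stepResponse, ht]

theorem continuous_stepResponse (hα : 0 < α) : Continuous (stepResponse α lam) :=
  (intervalIntegral.continuous_primitive (intervalIntegrable_mlKernel lam hα hα) 0).comp
    (continuous_id.max continuous_const)

theorem hasDerivAt_stepResponse (hα : 0 < α) (ht : 0 < t) :
    HasDerivAt (stepResponse α lam) (resolventKernel α lam t) t := by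
  have hK := continuousOn_mlKernel (β := α) lam hα
  refine (intervalIntegral.integral_hasDerivAt_right (intervalIntegrable_mlKernel lam hα hα 0 t)
    (hK.stronglyMeasurableAtFilter isOpen_Ioi t ht)
    (hK.continuousAt (Ioi_mem_nhds ht))).congr_of_eventuallyEq ?_
  filter_upwards [Ioi_mem_nhds ht] with s hs
  rw [stepResponse, max_eq_left (le_of_lt hs)]
  rfl

theorem stepResponse_eq_mlKernel (hα : 0 < α) (ht : 0 < t) :
    stepResponse α lam t = mlKernel α (α + 1) lam t := by
  rw [← integral_mlKernel_sub_mul_powKernel lam hα hα one_pos ht, stepResponse, max_eq_left ht.le]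
  simp only [powKernel_one, mul_one, resolventKernel_eq_mlKernel,
    intervalIntegral.integral_comp_sub_left (mlKernel α α lam), sub_self, sub_zero]

theorem caputo_stepResponse (hα0 : 0 < α) (hα1 : α < 1) (ht : 0 < t) :
    caputo α (stepResponse α lam) t = mlKernel α 1 lam t := by
  have iK := intervalIntegrable_mlKernel (β := α) lam hα0 hα0
  have swap : ∀ s, mlKernel α α lam (t - (t - s)) * powKernel (1 - α) (t - s)
      = (Real.Gamma (1 - α))⁻¹ * ((t - s) ^ (-α) * mlKernel α α lam s) := fun s => by
    rw [powKernel, sub_sub_cancel, sub_sub_cancel_left]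
    ring
  have hint :
      IntervalIntegrable (fun s => (t - s) ^ (-α) • resolventKernel α lam s) volume 0 t := by
    have h := ((intervalIntegrable_mlKernel_sub_mul lam hα0 hα0 (sub_pos.2 hα1) ht).comp_sub_left
      t).symm
    simp only [swap, sub_self, sub_zero] at h
    refine (h.const_mul (Real.Gamma (1 - α))).congr fun s _ => ?_
    exact mul_inv_cancel_left₀ (Real.Gamma_pos_of_pos (sub_pos.2 hα1)).ne' _
  rw [caputo_eq_fracInt hα0 ht (iK 0 t) hint fun s hs => ?_]
  · calc fracInt (1 - α) (resolventKernel α lam) t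
        = ∫ s in (0 : ℝ)..t, mlKernel α α lam (t - (t - s)) * powKernel (1 - α) (t - s) := by
          simp only [fracInt, swap, intervalIntegral.integral_const_mul, sub_sub_cancel_left,
            smul_eq_mul, resolventKernel_eq_mlKernel]
      _ = ∫ s in (0 : ℝ)..t, mlKernel α α lam (t - s) * powKernel (1 - α) s := by
          rw [intervalIntegral.integral_comp_sub_left
            (fun s => mlKernel α α lam (t - s) * powKernel (1 - α) s), sub_self, sub_zero]
      _ = mlKernel α 1 lam t := by
          rw [integral_mlKernel_sub_mul_powKernel lam hα0 hα0 (sub_pos.2 hα1) ht, add_sub_cancel]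
  · rw [stepResponse, stepResponse, max_eq_left ht.le, max_eq_left hs.1]
    exact intervalIntegral.integral_interval_sub_left (iK 0 t) (iK 0 s)

theorem caputo_stepResponse_add (hα0 : 0 < α) (hα1 : α < 1) (ht : 0 < t) :
    caputo α (stepResponse α lam) t + lam * stepResponse α lam t = 1 := by
  rw [caputo_stepResponse lam hα0 hα1 ht, stepResponse_eq_mlKernel lam hα0 ht,
    mlKernel_add_lam_mul_mlKernel lam hα0 ht, powKernel_one]

theorem caputoIntegrableAt_stepResponse_sub (hα0 : 0 < α) (hα1 : α < 1) (hh : 0 ≤ h) (ht : h < t) :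
    CaputoIntegrableAt α (fun s => stepResponse α lam (s - h)) t := by
  have hcont := (continuous_stepResponse lam hα0).comp (continuous_sub_right h)
  have hderiv := (hasDerivAt_stepResponse lam hα0 (sub_pos.2 ht)).comp_sub_const t h
  refine .of_isBigO hα1 (hh.trans_lt ht) (hcont.integrableOn_Icc.mono_set Ioo_subset_Icc_self) ?_
  refine (hderiv.differentiableAt.isBigO_sub.neg_left.neg_right.mono nhdsWithin_le_nhds).congr ?_ ?_
  all_goals exact fun s => neg_sub _ _

theorem caputo_stepResponse_sub_add (hα0 : 0 < α) (hα1 : α < 1) (hh : 0 ≤ h) (ht : h < t) :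
    caputo α (fun s => stepResponse α lam (s - h)) t + lam * stepResponse α lam (t - h) = 1 := by
  set w : ℝ → ℝ := fun s => stepResponse α lam (s - h) with hw
  have hint : CaputoIntegrableAt α w t :=
    caputoIntegrableAt_stepResponse_sub lam hα0 hα1 hh ht
  have w_eq_zero : ∀ s ≤ h, w s = 0 := fun s hs =>
    stepResponse_of_nonpos lam α (sub_nonpos.2 hs)
  have no_history : ∫ s in (0 : ℝ)..h, (α * (t - s) ^ (-α - 1)) • w s = 0 := by
    rw [intervalIntegral.integral_zero_ae]
    filter_upwards with s hs
    simp [w_eq_zero s (uIoc_of_le hh ▸ hs).2]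
  have restart := rlDeriv_comp_add_right hh ht hint
  rw [no_history, smul_zero, add_zero, rlDeriv_eq_caputo_add, rlDeriv_eq_caputo_add,
    w_eq_zero 0 hh, zero_add, w_eq_zero h le_rfl] at restart
  simp only [hw, add_sub_cancel_right, smul_zero, add_zero] at restart
  rw [← restart, caputo_stepResponse_add lam hα0 hα1 (sub_pos.2 ht)]

theorem monotone_stepResponse (hα0 : 0 < α) (hα1 : α < 1) (hlam : 0 ≤ lam) :
    Monotone (stepResponse α lam) := by
  intro a b hab
  rcases le_or_gt b 0 with hb | hb
  · rw [stepResponse_of_nonpos lam α hb, stepResponse_of_nonpos lam α (hab.trans hb)]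
  set U := stepResponse α lam
  have hUc : Continuous U := continuous_stepResponse lam hα0
  have hh : 0 ≤ b - a := sub_nonneg.2 hab
  have U0 : ∀ s ≤ 0, U s = 0 := fun s => stepResponse_of_nonpos lam α
  suffices 0 ≤ U b - U (b - (b - a)) by rw [sub_sub_cancel] at this; linarith
  refine nonneg_of_forall_caputo_add_nonneg (v := fun s => U s - U (s - (b - a))) hα0 hα1 hlam
    (by fun_prop) (by simp [U0 0 le_rfl, U0 (a - b) (by linarith)]) ?_ b ⟨hb.le, le_rfl⟩
  rintro t ⟨ht, -⟩
  have hUt := caputo_stepResponse_add lam hα0 hα1 ht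
  rcases le_or_gt t (b - a) with hth | hth
  · have same : EqOn (fun s => U s - U (s - (b - a))) U (Icc 0 t) := fun s hs => by
      simp [U0 (s - (b - a)) (by linarith [hs.2])]
    rw [caputo_congr ht.le same, U0 (t - (b - a)) (by linarith), sub_zero, hUt]
    exact zero_le_one
  · have hsub := caputo_stepResponse_sub_add lam hα0 hα1 hh hth
    have iU : CaputoIntegrableAt α U t := by
      simpa using caputoIntegrableAt_stepResponse_sub lam hα0 hα1 le_rfl ht
    rw [caputo_sub iU (caputoIntegrableAt_stepResponse_sub lam hα0 hα1 hh hth)]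
    linarith

theorem resolventKernel_nonneg (hα0 : 0 < α) (hα1 : α < 1) (ht : 0 < t) :
    0 ≤ resolventKernel α lam t := by
  rcases le_total 0 lam with hlam | hlam
  · exact (hasDerivAt_stepResponse lam hα0 ht).nonneg_of_monotone
      (monotone_stepResponse lam hα0 hα1 hlam)
  · exact (hasSum_mlKernel lam hα0 ht).nonneg fun j =>
      mul_nonneg (pow_nonneg (neg_nonneg.2 hlam) j) (powKernel_nonneg (by positivity) ht.le)

end Positivity

/-! ### The comparison principle -/

/-- The regularity in time on which the comparison principle rests: `v` is essentially bounded on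
`(0, t)`, and Lipschitz on `[ε, t]` for every `ε ∈ (0, t)`. -/
structure LocLipschitz {X : Type*} [NormedAddCommGroup X] (t : ℝ) (v : ℝ → X) : Prop where
  memLinfty : MemLinfty 0 t v
  lipschitz : ∀ ε ∈ Ioo 0 t, ∃ K, LipschitzOnWith K v (Icc ε t)

namespace LocLipschitz

variable {X : Type*} [NormedAddCommGroup X] {s t : ℝ} {v w : ℝ → X}

theorem integrableOn (hv : LocLipschitz t v) : IntegrableOn v (Ioo 0 t) :=
  hv.memLinfty.integrable le_top

theorem mono (hv : LocLipschitz t v) (hst : s ≤ t) : LocLipschitz s v where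
  memLinfty := hv.memLinfty.mono_measure
    (Measure.restrict_mono (Ioo_subset_Ioo_right hst) le_rfl)
  lipschitz ε hε := (hv.lipschitz ε ⟨hε.1, hε.2.trans_le hst⟩).imp fun _ h =>
    h.mono (Icc_subset_Icc_right hst)

theorem norm (hv : LocLipschitz t v) : LocLipschitz t fun s => ‖v s‖ where
  memLinfty := hv.memLinfty.norm
  lipschitz ε hε := (hv.lipschitz ε hε).imp fun _ h => by
    simpa using! lipschitzWith_one_norm.comp_lipschitzOnWith h

theorem sub (hv : LocLipschitz t v) (hw : LocLipschitz t w) :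
    LocLipschitz t fun s => v s - w s where
  memLinfty := hv.memLinfty.sub hw.memLinfty
  lipschitz ε hε :=
    let ⟨_, hK⟩ := hv.lipschitz ε hε
    let ⟨_, hK'⟩ := hw.lipschitz ε hε
    ⟨_, hK.sub hK'⟩

theorem caputoIntegrableAt [NormedSpace ℝ X] {α : ℝ} (hα : α < 1) (ht : 0 < t)
    (hv : LocLipschitz t v) : CaputoIntegrableAt α v t := by
  obtain ⟨K, hK⟩ := hv.lipschitz (t / 2) ⟨by linarith, by linarith⟩
  refine .of_isBigO hα ht hv.integrableOn (.of_bound K ?_)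
  filter_upwards [Ioo_mem_nhdsLT (by linarith : t / 2 < t)] with s hs
  simpa [dist_eq_norm] using
    hK.dist_le_mul t ⟨by linarith, le_rfl⟩ s ⟨hs.1.le, hs.2.le⟩

end LocLipschitz

section Comparison

theorem ofReal_integral_le_lintegral_ofReal {X : Type*} [MeasurableSpace X] {μ : Measure X}
    (f : X → ℝ) : ENNReal.ofReal (∫ x, f x ∂μ) ≤ ∫⁻ x, ENNReal.ofReal (f x) ∂μ := by
  by_cases hf : Integrable f μ
  · rw [integral_eq_lintegral_pos_part_sub_lintegral_neg_part hf]
    exact ENNReal.ofReal_le_of_le_toReal (sub_le_self _ ENNReal.toReal_nonneg)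
  · simp [integral_undef hf]

variable {α ε t : ℝ} {w : ℝ → ℝ}

theorem eq_integral_resolventKernel_mul_of_restart (lam : ℝ) (hα0 : 0 < α) (hα1 : α < 1)
    (hε : ε ∈ Ioo 0 t) (hw : LocLipschitz t w) (hw0 : w 0 = 0) :
    w t = ∫ τ in ε..t, resolventKernel α lam (t - τ) * (caputo α w τ + lam * w τ
      + (Real.Gamma (1 - α))⁻¹ * ∫ s in (0 : ℝ)..ε, α * (τ - s) ^ (-α - 1) * w s) := by
  obtain ⟨K, hK⟩ := hw.lipschitz ε hε
  have shifted : LipschitzOnWith K (fun s => w (s + ε)) (Icc 0 (t - ε)) := by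
    have h := hK.comp ((LipschitzWith.id.add (.const ε)).lipschitzOnWith (s := Icc 0 (t - ε)))
      fun s hs => ⟨by simpa using hs.1, by simpa using add_le_add_left hs.2 ε⟩
    simpa using! h
  have h := eq_integral_resolventKernel_mul lam hα0 hα1 (sub_pos.2 hε.2) shifted
  rw [sub_add_cancel] at h
  have shift := intervalIntegral.integral_comp_add_right (a := 0) (b := t - ε)
    (fun τ => resolventKernel α lam (t - τ)
      * (rlDeriv α (fun s => w (s + ε)) (τ - ε) + lam * w τ)) ε
  simp only [add_sub_cancel_right, zero_add, sub_add_cancel, ← sub_sub, sub_right_comm t] at shift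
  rw [h, shift]
  refine intervalIntegral.integral_congr_Ioo_of_le hε.2.le fun τ hτ => ?_
  have hτ0 := hε.1.trans hτ.1
  simp only [rlDeriv_comp_add_right hε.1.le hτ.1
    ((hw.mono hτ.2.le).caputoIntegrableAt hα1 hτ0), rlDeriv_eq_caputo_add, hw0, smul_eq_mul]
  ring

theorem history_le {M τ : ℝ} (hα0 : 0 < α) (hα1 : α < 1) (hε : 0 ≤ ε) (hτ : ε < τ)
    (hw : IntegrableOn w (Ioo 0 ε)) (hM : ∀ᵐ s ∂volume.restrict (Ioo 0 ε), w s ≤ M) :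
    (Real.Gamma (1 - α))⁻¹ * ∫ s in (0 : ℝ)..ε, α * (τ - s) ^ (-α - 1) * w s
      ≤ M * (powKernel (1 - α) (τ - ε) - powKernel (1 - α) τ) := by
  have hweight := uIcc_of_le hε ▸ continuousOn_caputo_weight α hτ
  have hint := ((intervalIntegrable_iff_integrableOn_Ioo_of_le hε).2 hw).continuousOn_mul hweight
  calc (Real.Gamma (1 - α))⁻¹ * ∫ s in (0 : ℝ)..ε, α * (τ - s) ^ (-α - 1) * w s
      ≤ (Real.Gamma (1 - α))⁻¹ * ∫ s in (0 : ℝ)..ε, α * (τ - s) ^ (-α - 1) * M := by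
        refine mul_le_mul_of_nonneg_left ?_ (inv_pos.2 (Real.Gamma_pos_of_pos (sub_pos.2 hα1))).le
        refine intervalIntegral.integral_mono_ae_restrict hε hint
          (hweight.intervalIntegrable.mul_const M) ?_
        rw [Measure.restrict_congr_set Ioo_ae_eq_Icc.symm]
        filter_upwards [hM, ae_restrict_mem measurableSet_Ioo] with s hs hmem
        have : 0 ≤ τ - s := by linarith [hmem.2]
        gcongr
    _ = M * (powKernel (1 - α) (τ - ε) - powKernel (1 - α) τ) := by
        rw [intervalIntegral.integral_mul_const, integral_caputo_weight hτ hε]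
        simp only [powKernel, sub_sub_cancel_left]
        ring

theorem intervalIntegrable_resolventKernel_sub_mul_sub (lam : ℝ) (hα0 : 0 < α) (hα1 : α < 1)
    (hε : ε < t) : IntervalIntegrable
      (fun τ => resolventKernel α lam (t - τ) * powKernel (1 - α) (τ - ε)) volume ε t := by
  have h := (intervalIntegrable_mlKernel_sub_mul lam hα0 hα0 (sub_pos.2 hα1)
    (sub_pos.2 hε)).comp_sub_right ε
  simpa only [resolventKernel_eq_mlKernel, zero_add, sub_add_cancel, sub_sub_sub_cancel_right]
    using h

theorem integral_resolventKernel_sub_mul_sub (lam : ℝ) (hα0 : 0 < α) (hα1 : α < 1) (hε : ε < t) :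
    ∫ τ in ε..t, resolventKernel α lam (t - τ) * powKernel (1 - α) (τ - ε)
      = mlKernel α 1 lam (t - ε) := by
  have h := intervalIntegral.integral_comp_sub_right (a := ε) (b := t)
    (fun s => resolventKernel α lam (t - ε - s) * powKernel (1 - α) s) ε
  have hval := integral_mlKernel_sub_mul_powKernel lam hα0 hα0 (sub_pos.2 hα1) (sub_pos.2 hε)
  rw [add_sub_cancel] at hval
  simp only [sub_self, sub_sub_sub_cancel_right] at h
  rw [h, ← hval]
  simp only [resolventKernel_eq_mlKernel]

theorem intervalIntegrable_restart_error (lam : ℝ) (hα0 : 0 < α) (hα1 : α < 1) (hε : ε ∈ Ioo 0 t) :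
    IntervalIntegrable (fun τ => resolventKernel α lam (t - τ)
      * (powKernel (1 - α) (τ - ε) - powKernel (1 - α) τ)) volume ε t := by
  have i0 := intervalIntegrable_resolventKernel_sub_mul_sub lam hα0 hα1 (hε.1.trans hε.2)
  simp only [sub_zero] at i0
  simp only [mul_sub]
  exact (intervalIntegrable_resolventKernel_sub_mul_sub lam hα0 hα1 hε.2).sub
    (i0.mono_set (uIcc_subset_uIcc_right (by grind [uIcc_of_le])))

theorem integral_restart_error (lam : ℝ) (hα0 : 0 < α) (hα1 : α < 1) (hε : ε ∈ Ioo 0 t) :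
    ∫ τ in ε..t, resolventKernel α lam (t - τ)
        * (powKernel (1 - α) (τ - ε) - powKernel (1 - α) τ)
      = mlKernel α 1 lam (t - ε) - mlKernel α 1 lam t
        + ∫ τ in (0 : ℝ)..ε, resolventKernel α lam (t - τ) * powKernel (1 - α) τ := by
  have ht := hε.1.trans hε.2
  have hmem : ε ∈ uIcc 0 t := by grind [uIcc_of_le]
  have i0 := intervalIntegrable_resolventKernel_sub_mul_sub lam hα0 hα1 ht
  have v0 := integral_resolventKernel_sub_mul_sub lam hα0 hα1 ht
  simp only [sub_zero] at i0 v0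
  have split := intervalIntegral.integral_add_adjacent_intervals
    (i0.mono_set (uIcc_subset_uIcc_left hmem)) (i0.mono_set (uIcc_subset_uIcc_right hmem))
  simp only [mul_sub]
  rw [intervalIntegral.integral_sub
    (intervalIntegrable_resolventKernel_sub_mul_sub lam hα0 hα1 hε.2)
    (i0.mono_set (uIcc_subset_uIcc_right hmem)),
    integral_resolventKernel_sub_mul_sub lam hα0 hα1 hε.2, ← v0, ← split]
  ring

theorem tendsto_integral_restart_error (lam : ℝ) (hα0 : 0 < α) (hα1 : α < 1) (ht : 0 < t) :
    Tendsto (fun ε => ∫ τ in ε..t, resolventKernel α lam (t - τ)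
      * (powKernel (1 - α) (τ - ε) - powKernel (1 - α) τ)) (𝓝[>] 0) (𝓝 0) := by
  have i0 := intervalIntegrable_resolventKernel_sub_mul_sub lam hα0 hα1 ht
  simp only [sub_zero] at i0
  have hml : Tendsto (fun ε => mlKernel α 1 lam (t - ε)) (𝓝[>] 0) (𝓝 (mlKernel α 1 lam t)) := by
    have hc := (continuousOn_mlKernel (β := 1) lam hα0).continuousAt (Ioi_mem_nhds ht)
    rw [← sub_zero t] at hc
    simpa using! (hc.comp (continuous_sub_left t).continuousAt).tendsto.mono_left nhdsWithin_le_nhds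
  have hprim : Tendsto (fun ε => ∫ τ in (0 : ℝ)..ε, resolventKernel α lam (t - τ)
      * powKernel (1 - α) τ) (𝓝[>] 0) (𝓝 0) := by
    have hc := intervalIntegral.continuousOn_primitive_interval'
      i0 left_mem_uIcc 0 left_mem_uIcc
    rw [ContinuousWithinAt, intervalIntegral.integral_same, uIcc_of_le ht.le] at hc
    exact hc.mono_left (nhdsWithin_le_of_mem (Icc_mem_nhdsGT ht))
  have h := (hml.sub_const (mlKernel α 1 lam t)).add hprim
  rw [sub_self, add_zero] at h
  refine h.congr' ?_
  filter_upwards [Ioo_mem_nhdsGT ht] with ε hε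
  exact (integral_restart_error lam hα0 hα1 hε).symm

theorem powKernel_le_powKernel_sub {τ : ℝ} (hα0 : 0 < α) (hα1 : α < 1) (hε : 0 ≤ ε) (hτ : ε < τ) :
    powKernel (1 - α) τ ≤ powKernel (1 - α) (τ - ε) :=
  mul_le_mul_of_nonneg_left
    (Real.rpow_le_rpow_of_nonpos (sub_pos.2 hτ) (sub_le_self _ hε) (by linarith))
    (inv_pos.2 (Real.Gamma_pos_of_pos (sub_pos.2 hα1))).le

theorem restart_integrand_le {lam M ρ τ : ℝ} (hα0 : 0 < α) (hα1 : α < 1) (hε : 0 ≤ ε)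
    (hτ : τ ∈ Ioo ε t) (hw : LocLipschitz t w) (hM : ∀ᵐ s ∂volume.restrict (Ioo 0 t), w s ≤ M)
    (hρ : caputo α w τ + lam * w τ ≤ ρ) :
    resolventKernel α lam (t - τ) * (caputo α w τ + lam * w τ
        + (Real.Gamma (1 - α))⁻¹ * ∫ s in (0 : ℝ)..ε, α * (τ - s) ^ (-α - 1) * w s)
      ≤ resolventKernel α lam (t - τ) * ρ + M * (resolventKernel α lam (t - τ)
          * (powKernel (1 - α) (τ - ε) - powKernel (1 - α) τ)) := by
  have subset : Ioo 0 ε ⊆ Ioo 0 t := Ioo_subset_Ioo_right (hτ.1.trans hτ.2).le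
  have history := history_le hα0 hα1 hε hτ.1 (hw.integrableOn.mono_set subset)
    (ae_restrict_of_ae_restrict_of_subset subset hM)
  rw [mul_left_comm M, ← mul_add]
  exact mul_le_mul_of_nonneg_left (add_le_add hρ history)
    (resolventKernel_nonneg lam hα0 hα1 (sub_pos.2 hτ.2))

theorem ofReal_le_caputoResolventENN_add {lam M : ℝ} {r : ℝ → ℝ} (hα0 : 0 < α) (hα1 : α < 1)
    (hε : ε ∈ Ioo 0 t) (hw : LocLipschitz t w) (hw0 : w 0 = 0) (hM0 : 0 ≤ M)
    (hM : ∀ᵐ s ∂volume.restrict (Ioo 0 t), w s ≤ M)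
    (hr : ∀ s ∈ Ioo 0 t, caputo α w s + lam * w s ≤ r s) :
    ENNReal.ofReal (w t) ≤ caputoResolventENN α lam r t
      + ENNReal.ofReal (M * ∫ τ in ε..t, resolventKernel α lam (t - τ)
          * (powKernel (1 - α) (τ - ε) - powKernel (1 - α) τ)) := by
  set error : ℝ → ℝ := fun τ =>
    M * (resolventKernel α lam (t - τ) * (powKernel (1 - α) (τ - ε) - powKernel (1 - α) τ))
  have error_nonneg : ∀ᵐ τ ∂volume.restrict (Ioo ε t), 0 ≤ error τ := by
    filter_upwards [ae_restrict_mem measurableSet_Ioo] with τ hτ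
    exact mul_nonneg hM0 (mul_nonneg (resolventKernel_nonneg lam hα0 hα1 (sub_pos.2 hτ.2))
      (sub_nonneg.2 (powKernel_le_powKernel_sub hα0 hα1 hε.1.le hτ.1)))
  have error_integrable : IntegrableOn error (Ioo ε t) :=
    (intervalIntegrable_iff_integrableOn_Ioo_of_le hε.2.le).1
      ((intervalIntegrable_restart_error lam hα0 hα1 hε).const_mul M)
  rw [eq_integral_resolventKernel_mul_of_restart lam hα0 hα1 hε hw hw0,
    ← intervalIntegral.integral_const_mul, intervalIntegral.integral_of_le hε.2.le,
    intervalIntegral.integral_of_le hε.2.le, integral_Ioc_eq_integral_Ioo,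
    integral_Ioc_eq_integral_Ioo, ofReal_integral_eq_lintegral_ofReal error_integrable error_nonneg]
  refine (ofReal_integral_le_lintegral_ofReal _).trans ?_
  calc _ ≤ ∫⁻ τ in Ioo ε t, ENNReal.ofReal (resolventKernel α lam (t - τ) * r τ)
          + ENNReal.ofReal (error τ) := by
        exact setLIntegral_mono' measurableSet_Ioo fun τ hτ =>
          (ENNReal.ofReal_le_ofReal (restart_integrand_le hα0 hα1 hε.1.le hτ hw hM
            (hr τ ⟨hε.1.trans hτ.1, hτ.2⟩))).trans ENNReal.ofReal_add_le
    _ = (∫⁻ τ in Ioo ε t, ENNReal.ofReal (resolventKernel α lam (t - τ) * r τ))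
          + ∫⁻ τ in Ioo ε t, ENNReal.ofReal (error τ) :=
        lintegral_add_right' _ error_integrable.aestronglyMeasurable.aemeasurable.ennreal_ofReal
    _ ≤ _ := add_le_add_left (lintegral_mono_set (Ioo_subset_Ioo_left hε.1.le)) _

theorem ofReal_le_caputoResolventENN {lam : ℝ} {r : ℝ → ℝ} (hα0 : 0 < α) (hα1 : α < 1)
    (ht : 0 < t) (hw : LocLipschitz t w) (hw0 : w 0 = 0)
    (hr : ∀ s ∈ Ioo 0 t, caputo α w s + lam * w s ≤ r s) :
    ENNReal.ofReal (w t) ≤ caputoResolventENN α lam r t := by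
  set M := lpNorm w ∞ (volume.restrict (Ioo 0 t))
  have hM : ∀ᵐ s ∂volume.restrict (Ioo 0 t), w s ≤ M :=
    (ae_le_lpNorm_exponent_top hw.memLinfty).mono fun s hs => (le_abs_self _).trans hs
  have error := ENNReal.tendsto_ofReal ((tendsto_integral_restart_error lam hα0 hα1 ht).const_mul M)
  rw [mul_zero, ENNReal.ofReal_zero] at error
  have bound := (tendsto_const_nhds (x := caputoResolventENN α lam r t)).add error
  rw [add_zero] at bound
  refine ge_of_tendsto bound ?_
  filter_upwards [Ioo_mem_nhdsGT ht] with ε hε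
  exact ofReal_le_caputoResolventENN_add hα0 hα1 hε hw hw0 lpNorm_nonneg hM hr

theorem le_caputoResolvent_of_ofReal_le {lam x : ℝ} {r : ℝ → ℝ} (hα0 : 0 < α) (hα1 : α < 1)
    (ht : 0 ≤ t) (hr : ∀ s ∈ Ioo 0 t, 0 ≤ r s)
    (hint : IntervalIntegrable (fun s => resolventKernel α lam (t - s) * r s) volume 0 t)
    (hx : ENNReal.ofReal x ≤ caputoResolventENN α lam r t) : x ≤ caputoResolvent α lam r t := by
  have nonneg : ∀ᵐ s ∂volume.restrict (Ioo 0 t), 0 ≤ resolventKernel α lam (t - s) * r s := by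
    filter_upwards [ae_restrict_mem measurableSet_Ioo] with s hs
    exact mul_nonneg (resolventKernel_nonneg lam hα0 hα1 (sub_pos.2 hs.2)) (hr s hs)
  rw [intervalIntegrable_iff_integrableOn_Ioo_of_le ht] at hint
  rw [caputoResolvent, intervalIntegral.integral_of_le ht, integral_Ioc_eq_integral_Ioo]
  rwa [caputoResolventENN, ← ofReal_integral_eq_lintegral_ofReal hint nonneg,
    ENNReal.ofReal_le_ofReal_iff (integral_nonneg_of_ae nonneg)] at hx

end Comparison

theorem TimeRegular.locLipschitz {X : Type*} [NormedAddCommGroup X] [NormedSpace ℝ X] {T t : ℝ}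
    {v : ℝ → X} (h : TimeRegular T v) (ht : t ∈ Ioc 0 T) : LocLipschitz t v where
  memLinfty := (h (t / 2) t (by linarith [ht.1]) (by linarith [ht.1]) ht.2).1
  lipschitz ε hε := by
    obtain ⟨-, g, hg, primitive⟩ := (h ε t hε.1 hε.2 ht.2).2
    have bound : ∀ᵐ x, x ∈ Ioc ε t → ‖g x‖ ≤ lpNorm g ∞ (volume.restrict (Ioo ε t)) := by
      rw [← ae_restrict_iff' measurableSet_Ioc, Measure.restrict_congr_set Ioo_ae_eq_Ioc.symm]
      exact ae_le_lpNorm_exponent_top hg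
    refine ⟨(lpNorm g ∞ (volume.restrict (Ioo ε t))).toNNReal, .of_dist_le' fun r hr s hs => ?_⟩
    rw [dist_eq_norm, primitive s hs r hr, Real.dist_eq]
    refine intervalIntegral.norm_integral_le_of_norm_le_const_ae ?_
    rw [← uIcc_of_le hε.2.le] at hs hr
    filter_upwards [bound] with x hx hxs
    exact hx (uIoc_of_le hε.2.le ▸
      uIoc_subset_uIoc_of_uIcc_subset_uIcc (uIcc_subset_uIcc hs hr) hxs)

section InnerProductSpace

variable {H : Type*} [NormedAddCommGroup H] [InnerProductSpace ℝ H] {α t : ℝ} {e : ℝ → H}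

theorem norm_mul_norm_sub_norm_le_inner_sub (x y : H) :
    ‖x‖ * (‖x‖ - ‖y‖) ≤ inner ℝ x (x - y) := by
  rw [inner_sub_right, real_inner_self_eq_norm_sq, mul_sub, ← sq]
  exact sub_le_sub_left (real_inner_le_norm x y) _

theorem norm_mul_caputo_norm_le [CompleteSpace H] (hα0 : 0 < α) (hα1 : α < 1) (ht : 0 ≤ t)
    (he : CaputoIntegrableAt α e t) (he' : CaputoIntegrableAt α (fun s => ‖e s‖) t) :
    ‖e t‖ * caputo α (fun s => ‖e s‖) t ≤ inner ℝ (e t) (caputo α e t) := by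
  have comm := ContinuousLinearMap.intervalIntegral_comp_comm (innerSL ℝ (e t)) he
  have hint : IntervalIntegrable
      (fun s => (α * (t - s) ^ (-α - 1)) * inner ℝ (e t) (e t - e s)) volume 0 t := by
    simpa only [IntervalIntegrable, IntegrableOn, innerSL_apply_apply, inner_smul_right] using
      And.intro ((innerSL ℝ (e t)).integrable_comp he.1) ((innerSL ℝ (e t)).integrable_comp he.2)
  simp only [innerSL_apply_apply, inner_smul_right] at comm
  simp only [caputo, inner_smul_right, inner_add_right, ← comm, smul_eq_mul]
  rw [mul_left_comm, mul_add, mul_left_comm ‖e t‖, ← intervalIntegral.integral_const_mul]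
  gcongr
  · exact norm_mul_norm_sub_norm_le_inner_sub _ _
  · refine intervalIntegral.integral_mono_on ht (he'.const_mul _) hint fun s hs => ?_
    rw [mul_left_comm]
    have : 0 ≤ t - s := sub_nonneg.2 hs.2
    gcongr
    exact norm_mul_norm_sub_norm_le_inner_sub _ _

theorem caputo_norm_add_le [CompleteSpace H] {lam ρ : ℝ} (hα0 : 0 < α) (hα1 : α < 1) (ht : 0 < t)
    (he : LocLipschitz t e) (hρ : 0 ≤ ρ)
    (h : inner ℝ (e t) (caputo α e t) + lam * ‖e t‖ ^ 2 ≤ ρ * ‖e t‖) :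
    caputo α (fun s => ‖e s‖) t + lam * ‖e t‖ ≤ ρ := by
  rcases (norm_nonneg (e t)).eq_or_lt with hzero | hpos
  · have hmin : caputo α (fun s => ‖e s‖) t ≤ powKernel (1 - α) t * (‖e t‖ - ‖e 0‖) :=
      caputo_le_of_forall_le hα0 hα1 ht.le fun s _ => hzero ▸ norm_nonneg _
    have := mul_nonneg (powKernel_nonneg (sub_pos.2 hα1) ht.le) (norm_nonneg (e 0))
    rw [← hzero] at hmin ⊢
    linarith
  · have chain := norm_mul_caputo_norm_le hα0 hα1 ht.le (he.caputoIntegrableAt hα1 ht)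
      (he.norm.caputoIntegrableAt hα1 ht)
    refine le_of_mul_le_mul_left ?_ hpos
    linarith

end InnerProductSpace

/-! ### The energy identity -/

section Energy

variable {d : ℕ} {Ω : Set (Rd d)}

theorem IsTest.sub {φ ψ : Rd d → ℝ} (hφ : IsTest Ω φ) (hψ : IsTest Ω ψ) :
    IsTest Ω fun x => φ x - ψ x :=
  ⟨hφ.1.sub hψ.1, hφ.2.1.sub hψ.2.1, (tsupport_sub φ ψ).trans (union_subset hφ.2.2 hψ.2.2)⟩

theorem IsTest.gradient_sub {φ ψ : Rd d → ℝ} (hφ : IsTest Ω φ) (hψ : IsTest Ω ψ) (x : Rd d) :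
    gradient (fun x => φ x - ψ x) x = gradient φ x - gradient ψ x := by
  simp only [gradient]
  rw [fderiv_fun_sub (hφ.1.differentiable (by simp) x) (hψ.1.differentiable (by simp) x), map_sub]

theorem H01.sub_mem {z z' : L2 Ω × L2Vec Ω} (hz : z ∈ H01 Ω) (hz' : z' ∈ H01 Ω) :
    z - z' ∈ H01 Ω := by
  refine map_mem_closure₂ continuous_sub hz hz' ?_
  rintro a ⟨φ, hφ, ha, hda⟩ b ⟨ψ, hψ, hb, hdb⟩
  refine ⟨fun x => φ x - ψ x, hφ.sub hψ, ?_, ?_⟩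
  · filter_upwards [Lp.coeFn_sub a.1 b.1, ha, hb] with x hsub ha hb
    rw [Prod.fst_sub, hsub, Pi.sub_apply, ha, hb]
  · filter_upwards [Lp.coeFn_sub a.2 b.2, hda, hdb] with x hsub ha hb
    rw [Prod.snd_sub, hsub, Pi.sub_apply, ha, hb, hφ.gradient_sub hψ]

namespace EllipticOperator

variable (L : EllipticOperator Ω)

theorem memLp_flux (v : L2 Ω) (dv : L2Vec Ω) :
    MemLp (fun x => L.A x (dv x) + v x • L.p x) 2 (volume.restrict Ω) :=
  ((ContinuousLinearMap.id ℝ (Rd d →L[ℝ] Rd d)).memLp_of_bilin 2 L.memLp_A (Lp.memLp dv)).add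
    (L.memLp_p.smul (Lp.memLp v))

theorem memLp_lowerOrder (v : L2 Ω) (dv : L2Vec Ω) :
    MemLp (fun x => inner ℝ (L.q x) (dv x) + L.c x * v x) 2 (volume.restrict Ω) :=
  ((innerSL ℝ).memLp_of_bilin 2 L.memLp_q (Lp.memLp dv)).add ((Lp.memLp v).mul L.memLp_c)

/-- The flux `A ∇v + v p` as an element of `L_2(Ω)ᵈ`. -/
noncomputable def flux (v : L2 Ω) (dv : L2Vec Ω) : L2Vec Ω := (L.memLp_flux v dv).toLp

/-- The non-divergence part `q · ∇v + c v` of `𝓛 v` as an element of `L_2(Ω)`. -/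
noncomputable def lowerOrder (v : L2 Ω) (dv : L2Vec Ω) : L2 Ω := (L.memLp_lowerOrder v dv).toLp

theorem pairing_eq_inner (v : L2 Ω) (dv : L2Vec Ω) (w : L2 Ω) (dw : L2Vec Ω) {φ : Rd d → ℝ}
    {dφ : Rd d → Rd d} (hw : w =ᵐ[volume.restrict Ω] φ) (hdw : dw =ᵐ[volume.restrict Ω] dφ) :
    L.pairing v dv φ dφ = inner ℝ (L.flux v dv) dw + inner ℝ (L.lowerOrder v dv) w := by
  rw [L2.inner_def, L2.inner_def, ← integral_add (L2.integrable_inner _ _)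
    (L2.integrable_inner _ _)]
  refine integral_congr_ae ?_
  filter_upwards [(L.memLp_flux v dv).coeFn_toLp, (L.memLp_lowerOrder v dv).coeFn_toLp, hw, hdw]
    with x hflux hlower hw hdw
  rw [flux, lowerOrder, hflux, hlower, hw, hdw, inner_add_left, real_inner_smul_left]
  simp only [RCLike.inner_apply, conj_trivial]
  ring

theorem flux_sub (v v' : L2 Ω) (dv dv' : L2Vec Ω) :
    L.flux (v - v') (dv - dv') = L.flux v dv - L.flux v' dv' := by
  rw [flux, flux, flux, ← MemLp.toLp_sub]
  refine MemLp.toLp_congr _ _ ?_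
  filter_upwards [Lp.coeFn_sub v v', Lp.coeFn_sub dv dv'] with x hv hdv
  simp only [hv, hdv, Pi.sub_apply, map_sub]
  module

theorem lowerOrder_sub (v v' : L2 Ω) (dv dv' : L2Vec Ω) :
    L.lowerOrder (v - v') (dv - dv') = L.lowerOrder v dv - L.lowerOrder v' dv' := by
  rw [lowerOrder, lowerOrder, lowerOrder, ← MemLp.toLp_sub]
  refine MemLp.toLp_congr _ _ ?_
  filter_upwards [Lp.coeFn_sub v v', Lp.coeFn_sub dv dv'] with x hv hdv
  simp only [hv, hdv, Pi.sub_apply, inner_sub_right]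
  ring

end EllipticOperator

theorem integral_mul_eq_inner (v w : L2 Ω) {φ : Rd d → ℝ} (hw : w =ᵐ[volume.restrict Ω] φ) :
    ∫ x in Ω, v x * φ x = inner ℝ v w := by
  rw [L2.inner_def]
  refine integral_congr_ae ?_
  filter_upwards [hw] with x h
  rw [h, RCLike.inner_apply, conj_trivial, mul_comm]

/-- The data `f` need not be square integrable, but it cancels from the difference of the two
equations for test functions, and what is left extends to `H_0^1(Ω)` by density. -/
theorem HasResidualAt.energy_identity {L : EllipticOperator Ω} {α t : ℝ} {f : Rd d → ℝ → ℝ}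
    {v v' : ℝ → L2 Ω} {R R' : L2 Ω} (h : HasResidualAt L α f v t R)
    (h' : HasResidualAt L α f v' t R') :
    ∃ de : L2Vec Ω, (v t - v' t, de) ∈ H01 Ω ∧
      inner ℝ (caputo α v t - caputo α v' t) (v t - v' t)
        + L.pairing ((v t - v' t : L2 Ω) : Rd d → ℝ) de ((v t - v' t : L2 Ω) : Rd d → ℝ) de
        = inner ℝ (R - R') (v t - v' t) := by
  obtain ⟨dv, hdv, weak⟩ := h
  obtain ⟨dv', hdv', weak'⟩ := h'
  have hmem : (v t - v' t, dv - dv') ∈ H01 Ω := H01.sub_mem hdv hdv'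
  refine ⟨dv - dv', hmem, ?_⟩
  rw [L.pairing_eq_inner _ _ _ _ .rfl .rfl]
  have closed : IsClosed {z : L2 Ω × L2Vec Ω | inner ℝ (caputo α v t - caputo α v' t) z.1
      + (inner ℝ (L.flux (v t - v' t) (dv - dv')) z.2
        + inner ℝ (L.lowerOrder (v t - v' t) (dv - dv')) z.1) = inner ℝ (R - R') z.1} :=
    isClosed_eq (by fun_prop) (by fun_prop)
  refine closure_minimal ?_ closed hmem
  rintro z ⟨φ, hφ, hz, hdz⟩
  have weak := weak φ hφ
  have weak' := weak' φ hφ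
  rw [integral_mul_eq_inner _ _ hz, integral_mul_eq_inner _ _ hz,
    L.pairing_eq_inner _ _ _ _ hz hdz] at weak weak'
  simp only [mem_ofPred_eq, L.flux_sub, L.lowerOrder_sub, inner_sub_left]
  linarith

theorem HasResidualAt.caputo_norm_sub_add_le {L : EllipticOperator Ω} {α t lam : ℝ}
    {f : Rd d → ℝ → ℝ} {v v' : ℝ → L2 Ω} {R R' : L2 Ω} (hα0 : 0 < α) (hα1 : α < 1) (ht : 0 < t)
    (hL : ∀ v : L2 Ω, ∀ dv : L2Vec Ω, (v, dv) ∈ H01 Ω → lam * ‖v‖ ^ 2 ≤ L.pairing v dv v dv)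
    (hv : LocLipschitz t v) (hv' : LocLipschitz t v')
    (h : HasResidualAt L α f v t R) (h' : HasResidualAt L α f v' t R') :
    caputo α (fun s => ‖v s - v' s‖) t + lam * ‖v t - v' t‖ ≤ ‖R - R'‖ := by
  obtain ⟨de, hde, energy⟩ := h.energy_identity h'
  refine caputo_norm_add_le hα0 hα1 ht (hv.sub hv') (norm_nonneg _) ?_
  rw [caputo_sub (hv.caputoIntegrableAt hα1 ht) (hv'.caputoIntegrableAt hα1 ht), real_inner_comm]
  calc _ ≤ inner ℝ (caputo α v t - caputo α v' t) (v t - v' t) + L.pairing _ de _ de :=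
        add_le_add_right (hL _ _ hde) _
    _ = inner ℝ (R - R') (v t - v' t) := energy
    _ ≤ ‖R - R'‖ * ‖v t - v' t‖ := real_inner_le_norm _ _

end Energy

theorem theorem1 {d : ℕ} {Ω : Set (Rd d)} (hΩ : IsOpen Ω)
    {α T lam : ℝ} (hα0 : 0 < α) (hα1 : α < 1)
    (L : EllipticOperator Ω)
    (hL : ∀ v : L2 Ω, ∀ dv : L2Vec Ω, (v, dv) ∈ H01 Ω → lam * ‖v‖ ^ 2 ≤ L.pairing v dv v dv)
    (f : Rd d → ℝ → ℝ) (hf : ∀ t ∈ Ioc 0 T, LocallyIntegrableOn (fun x => f x t) Ω)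
    (u0 : L2 Ω) (u uh R : ℝ → L2 Ω)
    (hu : IsSolution L α T f u0 u) (hu_reg : TimeRegular T u)
    (huh_reg : TimeRegular T uh) (huh0 : uh 0 = u0)
    (hR : ∀ t ∈ Ioc 0 T, HasResidualAt L α f uh t (R t)) :
    ∀ t ∈ Ioc 0 T,
      ENNReal.ofReal ‖uh t - u t‖ ≤ caputoResolventENN α lam (fun s => ‖R s‖) t ∧
      (IntervalIntegrable (fun s => resolventKernel α lam (t - s) * ‖R s‖) volume 0 t →
        ‖uh t - u t‖ ≤ caputoResolvent α lam (fun s => ‖R s‖) t) := by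
  intro t ht
  have reg : ∀ s ∈ Ioc 0 t, LocLipschitz s uh ∧ LocLipschitz s u := fun s hs =>
    have hsT := Ioc_subset_Ioc_right ht.2 hs
    ⟨huh_reg.locLipschitz hsT, hu_reg.locLipschitz hsT⟩
  have initial : ‖uh 0 - u 0‖ = 0 := by rw [huh0, hu.1, sub_self, norm_zero]
  have inequality : ∀ s ∈ Ioo 0 t,
      caputo α (fun s => ‖uh s - u s‖) s + lam * ‖uh s - u s‖ ≤ ‖R s‖ := fun s hs => by
    have hst := Ioo_subset_Ioc_self hs
    have hsT := Ioc_subset_Ioc_right ht.2 hst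
    simpa only [sub_zero] using (hR s hsT).caputo_norm_sub_add_le hα0 hα1 hs.1 hL
      (reg s hst).1 (reg s hst).2 (hu.2 s hsT)
  have bound : ENNReal.ofReal ‖uh t - u t‖ ≤ caputoResolventENN α lam (fun s => ‖R s‖) t :=
    have ⟨hreg, hreg'⟩ := reg t ⟨ht.1, le_rfl⟩
    ofReal_le_caputoResolventENN hα0 hα1 ht.1 (hreg.sub hreg').norm initial inequality
  exact ⟨bound, fun hint => le_caputoResolvent_of_ofReal_le hα0 hα1 ht.1.le
    (fun _ _ => norm_nonneg _) hint bound⟩
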